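/- Let $(P,d)$ be a nonempty finite metric space, whose points are called sites, and let $k\ge 2$. A schedule of a robot (of maximum speed $1$) is an infinite sequence of sites $p_0,p_1,\dots$ with arrival and departure times $0\le a_0$, $a_n\le b_n$, $a_{n+1}-b_n\ge d(p_n,p_{n+1})$, $a_n\to\infty$; the robot visits $p_n$ at every time $t\in[a_n,b_n]$. A patrol schedule consists of such a schedule for each of $k$ robots. The latency of a site $s$ is the supremum of the lengths of the time intervals $(a,b)$, $0\le a<b$, during which no robot visits $s$ (and $0$ if there is no such interval), and the latency of a patrol schedule is the maximum latency of a site. Let $L$ be the optimal latency, that is, the infimum of the latencies of all patrol schedules for $k$ robots. A patrol schedule is a cyclic solution if $P$ is partitioned into nonempty sets $P_1,\dots,P_\ell$, $\ell\le k$, and the robots are distributed over these sets, with $k_i\ge 1$ robots for $P_i$ and $\sum_{i=1}^{\ell} k_i=k$, such that the $k_i$ robots of $P_i$ move at unit speed and in the same direction along one shortest closed tour $T_i$ through all the sites of $P_i$, each one at distance $\|T_i\|/k_i$ along the tour from the next, where $\|T_i\|$ is the length of $T_i$ (if $P_i$ is a single site, they stay there). Then there is a cyclic solution with latency at most $2\left(1-\frac1k\right)L$.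 -/

import Mathlib

open scoped ENNReal

namespace Patrol

/-- The schedule of one robot of maximum speed one: an infinite sequence of sites to visit, together
with the times at which the robot arrives at and leaves the `n`-th site of the sequence. The robot
stays at `site n` during `[arrive n, depart n]` and travels to the next site in between.
It may start anywhere (so it may reach its first site after time `0`). -/
structure RobotSchedule (P : Type*) [MetricSpace P] where
  site : ℕ → P
  arrive : ℕ → ℝ
  depart : ℕ → ℝ
  arrive_nonneg : 0 ≤ arrive 0
  arrive_le_depart : ∀ n, arrive n ≤ depart n
  speed_limit : ∀ n, dist (site n) (site (n + 1)) ≤ arrive (n + 1) - depart n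
  tendsto_arrive : Filter.Tendsto arrive Filter.atTop Filter.atTop

/-- The robot is at site `p` at time `t`. -/
def RobotSchedule.VisitsAt {P : Type*} [MetricSpace P] (f : RobotSchedule P) (p : P) (t : ℝ) :
    Prop :=
  ∃ n, f.site n = p ∧ f.arrive n ≤ t ∧ t ≤ f.depart n

/-- A patrol schedule for `k` robots. -/
abbrev Schedule (P : Type*) [MetricSpace P] (k : ℕ) : Type _ := Fin k → RobotSchedule P

/-- The latency of a site: the supremum of the lengths of the time intervals during which
no robot visits it. -/
noncomputable def Schedule.siteLatency {P : Type*} [MetricSpace P] {k : ℕ} (σ : Schedule P k)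
    (p : P) : ℝ≥0∞ :=
  ⨆ (a : ℝ) (b : ℝ) (_ : 0 ≤ a) (_ : a < b)
    (_ : ∀ t, a < t → t < b → ∀ r, ¬ (σ r).VisitsAt p t), ENNReal.ofReal (b - a)

/-- The latency of a schedule: the maximum latency of a site. -/
noncomputable def Schedule.latency {P : Type*} [MetricSpace P] {k : ℕ} (σ : Schedule P k) :
    ℝ≥0∞ :=
  ⨆ p : P, σ.siteLatency p

/-- The optimal latency of the `k`-robot patrol-scheduling problem on `P`. -/
noncomputable def optimalLatency (P : Type*) [MetricSpace P] (k : ℕ) : ℝ≥0∞ :=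
  ⨅ σ : Schedule P k, σ.latency

/-- The length of the closed tour `c 0, c 1, …, c m, c 0`; addition in `Fin (m + 1)` is cyclic. -/
noncomputable def tourLength {P : Type*} [MetricSpace P] {m : ℕ} (c : Fin (m + 1) → P) : ℝ :=
  ∑ i, dist (c i) (c (i + 1))

/-- The distance along the closed tour `c` from its first site `c 0` to its site `c i`. -/
noncomputable def arcLength {P : Type*} [MetricSpace P] {m : ℕ} (c : Fin (m + 1) → P)
    (i : Fin (m + 1)) : ℝ :=
  ∑ j ∈ Finset.Iio i, dist (c j) (c (j + 1))

/-- `c` is a tour of the set `S`: it lists every site of `S` exactly once. -/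
def IsTour {P : Type*} {m : ℕ} (S : Set P) (c : Fin (m + 1) → P) : Prop :=
  Function.Injective c ∧ Set.range c = S

/-- `c` is a travelling salesman tour of `S`, that is, a shortest tour of `S`.
(Two tours of `S` have the same number of sites.) -/
def IsTSPTour {P : Type*} [MetricSpace P] {m : ℕ} (S : Set P) (c : Fin (m + 1) → P) : Prop :=
  IsTour S c ∧ ∀ c' : Fin (m + 1) → P, IsTour S c' → tourLength c ≤ tourLength c'

/-- Going a distance `x` along the closed tour `c` from `c 0`, and around it as often as necessary
(backwards if `x < 0`), ends at the site `p`. A tour of length `0` consists of a single site,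
at which one then stays. -/
def TourAt {P : Type*} [MetricSpace P] {m : ℕ} (c : Fin (m + 1) → P) (x : ℝ) (p : P) : Prop :=
  (tourLength c = 0 ∧ p ∈ Set.range c) ∨
    ∃ (i : Fin (m + 1)) (z : ℤ), c i = p ∧ x = arcLength c i + z * tourLength c

/-- The combinatorial data of a cyclic solution: a partition of the sites into `numGroups`
nonempty groups, a travelling salesman tour of each group, and a distribution of all `k` robots
over the groups, with `numRobots i ≥ 1` robots for the `i`-th group (so `numGroups ≤ k`). -/
structure CyclicPlan (P : Type*) [MetricSpace P] (k : ℕ) where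
  numGroups : ℕ
  group : Fin numGroups → Set P
  group_nonempty : ∀ i, (group i).Nonempty
  group_disjoint : ∀ i j, i ≠ j → Disjoint (group i) (group j)
  group_cover : ∀ p, ∃ i, p ∈ group i
  lastIndex : Fin numGroups → ℕ
  tour : ∀ i, Fin (lastIndex i + 1) → P
  isTSPTour : ∀ i, IsTSPTour (group i) (tour i)
  numRobots : Fin numGroups → ℕ
  numRobots_pos : ∀ i, 0 < numRobots i
  robot : (Σ i, Fin (numRobots i)) ≃ Fin k

/-- A schedule is cyclic if, for some plan, the robots of each group move at unit speed along the
tour of the group, all in the same direction, evenly spaced: the `j`-th of the `kᵢ` robots on a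
tour of length `ℓ` has a head start of `j ℓ / kᵢ`. Here `phase i` is the position of the `0`-th
robot of the `i`-th group at time `0`. -/
def Schedule.IsCyclic {P : Type*} [MetricSpace P] {k : ℕ} (σ : Schedule P k) : Prop :=
  ∃ (C : CyclicPlan P k) (phase : Fin C.numGroups → ℝ),
    ∀ (i : Fin C.numGroups) (j : Fin (C.numRobots i)) (t : ℝ), 0 ≤ t → ∀ p : P,
      (σ (C.robot ⟨i, j⟩)).VisitsAt p t ↔
        TourAt (C.tour i) (phase i + t + j * (tourLength (C.tour i) / C.numRobots i)) p

end Patrol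

/-!
Measure time in units of a latency above the optimal one, and let the robots move in a metric space
that contains the sites. Give each robot a time window around time `0` such that the windows
together contain a visit of each site. When the window of a robot ends, at a site `p`, some robot,
the parent of the first one, has visited `p` at most one unit of time earlier and not after the
start of its own window. So following the first robot through its window and then the parent up
to the start of the parent's window takes time at most `1`, corrected by the difference of the two
starting times, which cancels along closed walks.

In the graph of the links from the robots to their parents, a component with `n` robots consists of
trees attached to a cycle. Walking along the cycle once and along each of the other links twice is
a closed walk of length at most `2 * n - 2`, or `2 * n - 1` if the cycle is a single robot. With `k`
robots in total, the first is at most `(2 - 2 / k) * n`, and so is the second if `2 * n ≤ k`. This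
leaves at most one component, a tree of more than `k / 2` robots whose root is its own parent. There
the starts of the windows of leaves are delayed step by step, until either enough time is saved or
the graph changes. A change that does not save enough time moves a window past one of finitely many
times or creates another loop, so that the process ends.

A closed walk through the sites of a group, shortcut, bounds the length of a shortest tour of
the group. As there are finitely many ways to group robots and sites, one of them serves all
latencies above the optimal one, and hence the optimal one itself.
-/

namespace Patrol

open scoped Finset lp

/-- There is a walk from `a` to `b` of length at most `ℓ` through all the points of `S`. The walk is
encoded by the distance `t s` that it has covered when it passes the point `s`. -/
def Walk {E : Type*} [MetricSpace E] (a b : E) (S : Set E) (ℓ : ℝ) : Prop :=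
  dist a b ≤ ℓ ∧ ∃ t : E → ℝ, (∀ s ∈ S, dist a s ≤ t s ∧ dist s b ≤ ℓ - t s) ∧
    ∀ s ∈ S, ∀ s' ∈ S, dist s s' ≤ |t s - t s'|

namespace Walk

variable {E : Type*} [MetricSpace E] {a b c : E} {S S' : Set E} {ℓ ℓ' : ℝ}

theorem mono (h : Walk a b S ℓ) (hS : S' ⊆ S) (hℓ : ℓ ≤ ℓ') : Walk a b S' ℓ' := by
  obtain ⟨hab, t, hends, hdist⟩ := h
  refine ⟨hab.trans hℓ, t, fun s hs => ⟨(hends s (hS hs)).1, ?_⟩,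
    fun s hs s' hs' => hdist s (hS hs) s' (hS hs')⟩
  linarith [(hends s (hS hs)).2]

theorem refl (a : E) : Walk a a {a} 0 := by
  refine ⟨by simp, fun _ => 0, ?_, ?_⟩ <;> simp

theorem reverse (h : Walk a b S ℓ) : Walk b a S ℓ := by
  obtain ⟨hab, t, hends, hdist⟩ := h
  refine ⟨by rwa [dist_comm], fun s => ℓ - t s, fun s hs => ⟨?_, ?_⟩, fun s hs s' hs' => ?_⟩
  · rw [dist_comm]
    exact (hends s hs).2
  · rw [dist_comm]
    linarith [(hends s hs).1]
  · rw [sub_sub_sub_cancel_left, abs_sub_comm]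
    exact hdist s hs s' hs'

theorem append (h : Walk a b S ℓ) (h' : Walk b c S' ℓ') : Walk a c (S ∪ S') (ℓ + ℓ') := by
  classical
  obtain ⟨hab, t, hends, hdist⟩ := h
  obtain ⟨hbc, t', hends', hdist'⟩ := h'
  have hcross : ∀ s ∈ S, ∀ s' ∈ S', dist s s' ≤ ℓ + t' s' - t s := fun s hs s' hs' => by
    linarith [dist_triangle s b s', (hends s hs).2, (hends' s' hs').1]
  refine ⟨(dist_triangle a b c).trans (add_le_add hab hbc),
    fun s => if s ∈ S then t s else ℓ + t' s, ?_, ?_⟩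
  · intro s hs
    by_cases hsS : s ∈ S
    · simp only [hsS, if_true]
      exact ⟨(hends s hsS).1, by linarith [dist_triangle s b c, (hends s hsS).2]⟩
    · have hsS' := hends' s (hs.resolve_left hsS)
      simp only [hsS, if_false]
      exact ⟨by linarith [dist_triangle a b s], by linarith⟩
  · intro s hs s' hs'
    by_cases hsS : s ∈ S <;> by_cases hsS' : s' ∈ S <;> simp only [hsS, hsS', if_true, if_false]
    · exact hdist s hsS s' hsS'
    · rw [abs_sub_comm]
      exact (hcross s hsS s' (hs'.resolve_left hsS')).trans (le_abs_self _)
    · rw [dist_comm]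
      exact (hcross s' hsS' s (hs.resolve_left hsS)).trans (le_abs_self _)
    · rw [add_sub_add_left_eq_sub]
      exact hdist' s (hs.resolve_left hsS) s' (hs'.resolve_left hsS')

theorem split (h : Walk a b S ℓ) (hc : c ∈ S) :
    ∃ S₁ S₂ ℓ₁ ℓ₂, Walk a c S₁ ℓ₁ ∧ Walk c b S₂ ℓ₂ ∧ S = S₁ ∪ S₂ ∧ ℓ₁ + ℓ₂ = ℓ := by
  obtain ⟨_, t, hends, hdist⟩ := h
  refine ⟨{s ∈ S | t s ≤ t c}, {s ∈ S | t c ≤ t s}, t c, ℓ - t c, ⟨(hends c hc).1, t, ?_, ?_⟩,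
    ⟨(hends c hc).2, fun s => t s - t c, ?_, ?_⟩, ?_, by ring⟩
  · rintro s ⟨hs, hsc⟩
    have := hdist s hs c hc
    rw [abs_sub_comm, abs_of_nonneg (by linarith)] at this
    exact ⟨(hends s hs).1, this⟩
  · exact fun s hs s' hs' => hdist s hs.1 s' hs'.1
  · rintro s ⟨hs, hsc⟩
    have := hdist c hc s hs
    rw [abs_sub_comm, abs_of_nonneg (by linarith)] at this
    exact ⟨this, by linarith [(hends s hs).2]⟩
  · intro s hs s' hs'
    rw [sub_sub_sub_cancel_right]
    exact hdist s hs.1 s' hs'.1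
  · ext s
    simp only [Set.mem_union, Set.mem_ofPred_eq, ← and_or_left]
    exact ⟨fun h => ⟨h, le_total _ _⟩, fun h => h.1⟩

theorem insert_left (h : Walk a b S ℓ) : Walk a b (insert a S) ℓ := by
  simpa only [Set.singleton_union, zero_add] using (refl a).append h

theorem insert_right (h : Walk a b S ℓ) : Walk a b (insert b S) ℓ :=
  h.reverse.insert_left.reverse

theorem rotate (h : Walk a a S ℓ) (hc : c ∈ S) : Walk c c S ℓ := by
  obtain ⟨S₁, S₂, ℓ₁, ℓ₂, h₁, h₂, rfl, rfl⟩ := h.split hc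
  exact (h₂.append h₁).mono (Set.union_comm _ _).subset (add_comm _ _).le

theorem merge (h : Walk a a S ℓ) (h' : Walk b b S' ℓ') (hc : c ∈ S) (hc' : c ∈ S') :
    Walk a a (S ∪ S') (ℓ + ℓ') := by
  obtain ⟨S₁, S₂, ℓ₁, ℓ₂, h₁, h₂, rfl, rfl⟩ := h.split hc
  refine ((h₁.append (h'.rotate hc')).append h₂).mono ?_ (by linarith)
  exact (Set.union_right_comm _ _ _).subset

theorem double (h : Walk a b S ℓ) : Walk a a (insert a (insert b S)) (2 * ℓ) :=
  (h.insert_right.insert_left.append h.reverse).mono Set.subset_union_left (by linarith)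

theorem of_lipschitz {x : ℝ → E} (hx : ∀ s t, dist (x s) (x t) ≤ |s - t|) {s t : ℝ}
    (hst : s ≤ t) :
    Walk (x s) (x t) (x '' Set.Icc s t) (t - s) := by
  have hpassage : ∀ p ∈ x '' Set.Icc s t, ∃ v, (s ≤ v ∧ v ≤ t) ∧ x v = p := fun p hp => hp
  choose! v hv hvx using hpassage
  have hforward : ∀ {u w}, u ≤ w → dist (x u) (x w) ≤ w - u := fun {u w} huw => by
    rw [← abs_of_nonneg (sub_nonneg.2 huw), abs_sub_comm]
    exact hx u w
  refine ⟨hforward hst, fun p => v p - s, fun p hp => ⟨?_, ?_⟩, fun p hp q hq => ?_⟩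
  · simpa only [hvx p hp] using hforward (hv p hp).1
  · simpa only [hvx p hp, sub_sub_sub_cancel_right] using hforward (hv p hp).2
  · simpa only [hvx p hp, hvx q hq, sub_sub_sub_cancel_right] using hx (v p) (v q)

end Walk

/-! ### Functional graphs -/

/-- Two points are linked if they lie in the same weakly connected component of the functional
graph of `f`. -/
def Linked {R : Type*} (f : R → R) (a b : R) : Prop := ∃ n m, f^[n] a = f^[m] b

section Linked

variable {R : Type*} {f : R → R} {a b c r : R}

namespace Linked

protected theorem refl (a : R) : Linked f a a := ⟨0, 0, rfl⟩

theorem symm (h : Linked f a b) : Linked f b a := by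
  obtain ⟨n, m, h⟩ := h
  exact ⟨m, n, h.symm⟩

theorem trans (h : Linked f a b) (h' : Linked f b c) : Linked f a c := by
  obtain ⟨n, m, h⟩ := h
  obtain ⟨n', m', h'⟩ := h'
  refine ⟨n' + n, m + m', ?_⟩
  rw [Function.iterate_add_apply, h, ← Function.iterate_add_apply, add_comm,
    Function.iterate_add_apply, h', ← Function.iterate_add_apply]

theorem iterate (a : R) (n : ℕ) : Linked f a (f^[n] a) := ⟨n, 0, rfl⟩

theorem apply (a : R) : Linked f a (f a) := ⟨1, 0, rfl⟩

theorem iff_of_forall_apply {p : R → Prop} (hab : Linked f a b)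
    (h : ∀ z, Linked f a z → (p z ↔ p (f z))) : p a ↔ p b := by
  have hiter : ∀ z, Linked f a z → ∀ n, p z ↔ p (f^[n] z) := fun z hz n => by
    induction n with
    | zero => rfl
    | succ n ih =>
      rw [Function.iterate_succ_apply']
      exact ih.trans (h _ (hz.trans (iterate z n)))
  obtain ⟨n, m, hnm⟩ := id hab
  rw [hiter a (Linked.refl a) n, hnm, ← hiter b hab m]

theorem exists_iterate_eq (hr : f r = r) (h : Linked f a r) : ∃ n, f^[n] a = r := by
  obtain ⟨n, m, h⟩ := h
  exact ⟨n, h.trans (Function.iterate_fixed hr m)⟩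

theorem eq_of_fixed (ha : f a = a) (hb : f b = b) (h : Linked f a b) : a = b := by
  obtain ⟨n, hn⟩ := h.exists_iterate_eq hb
  rw [← hn, Function.iterate_fixed ha]

theorem exists_first_meeting (h : Linked f a b) :
    ∃ n m, f^[n] a = f^[m] b ∧ (∀ i < n, ∀ j, f^[i] a ≠ f^[j] b) ∧
      ∀ j < m, f^[j] b ≠ f^[m] b := by
  classical
  refine ⟨Nat.find h, Nat.find (Nat.find_spec h), Nat.find_spec (Nat.find_spec h),
    fun i hi j hij => Nat.find_min h hi ⟨j, hij⟩, fun j hj hjm => ?_⟩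
  exact Nat.find_min (Nat.find_spec h) hj ((Nat.find_spec (Nat.find_spec h)).trans hjm.symm)

end Linked

theorem exists_minimalPeriod_pos [Finite R] (f : R → R) (a : R) :
    ∃ i, 0 < Function.minimalPeriod f (f^[i] a) := by
  obtain ⟨i, j, hij, h⟩ := Finite.exists_ne_map_eq_of_infinite fun n => f^[n] a
  wlog hlt : i < j generalizing i j
  · exact this j i hij.symm h.symm (by omega)
  refine ⟨i, Function.IsPeriodicPt.minimalPeriod_pos (n := j - i) (by omega) ?_⟩
  change f^[j - i] (f^[i] a) = f^[i] a
  rw [← Function.iterate_add_apply, Nat.sub_add_cancel hlt.le]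
  exact h.symm

/-- If `f^[n] a` is reached for the first time after `n` steps, the orbit of `a` cannot have become
periodic before. -/
theorem injOn_iterate_of_forall_ne {n : ℕ} (h : ∀ i < n, f^[i] a ≠ f^[n] a) :
    Set.InjOn (fun i => f^[i] a) (Set.Iio n) := by
  have hlt : ∀ i j, i < j → j < n → f^[i] a ≠ f^[j] a := by
    intro i j hij hj heq
    apply h (n - j + i) (by omega)
    rw [Function.iterate_add_apply, heq, ← Function.iterate_add_apply, Nat.sub_add_cancel hj.le]
  intro i hi j hj heq
  rcases lt_trichotomy i j with hij | hij | hij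
  exacts [absurd heq (hlt i j hij hj), hij, absurd heq.symm (hlt j i hij hi)]

section OrbitPrefix

variable [DecidableEq R]

/-- The first `n` points of the orbit of `a` under `f`. -/
def orbitPrefix (f : R → R) (a : R) (n : ℕ) : Finset R := (Finset.range n).image fun i => f^[i] a

theorem mem_orbitPrefix {n : ℕ} : b ∈ orbitPrefix f a n ↔ ∃ i < n, f^[i] a = b := by
  simp [orbitPrefix]

theorem orbitPrefix_succ (n : ℕ) :
    orbitPrefix f a (n + 1) = insert (f^[n] a) (orbitPrefix f a n) := by
  simp [orbitPrefix, Finset.range_add_one]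

theorem card_orbitPrefix {n : ℕ} (h : Set.InjOn (fun i => f^[i] a) (Set.Iio n)) :
    #(orbitPrefix f a n) = n := by
  rw [orbitPrefix, Finset.card_image_of_injOn (by simpa using h), Finset.card_range]

theorem sum_orbitPrefix_sub {M : Type*} [AddCommGroup M] (g : R → M) {n : ℕ}
    (h : Set.InjOn (fun i => f^[i] a) (Set.Iio n)) :
    ∑ z ∈ orbitPrefix f a n, (g (f z) - g z) = g (f^[n] a) - g a := by
  rw [orbitPrefix, Finset.sum_image (by simpa using h)]
  simp only [← Function.iterate_succ_apply' f]
  exact Finset.sum_range_sub (fun i => g (f^[i] a)) n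

theorem notMem_orbitPrefix_of_fixed {n : ℕ} (hr : f r = r) (h : ∀ i < n, f^[i] a ≠ f^[n] a) :
    r ∉ orbitPrefix f a n := by
  rw [mem_orbitPrefix]
  rintro ⟨i, hi, rfl⟩
  apply h i hi
  rw [← Nat.sub_add_cancel hi.le, Function.iterate_add_apply, Function.iterate_fixed hr]

end OrbitPrefix

section Component

variable [Fintype R]

open Classical in
/-- The weakly connected component of `a` in the functional graph of `f`. -/
noncomputable def component (f : R → R) (a : R) : Finset R := {z | Linked f a z}

@[simp]
theorem mem_component : b ∈ component f a ↔ Linked f a b := by simp [component]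

theorem self_mem_component (a : R) : a ∈ component f a := mem_component.2 (Linked.refl a)

theorem apply_mem_component : f b ∈ component f a ↔ b ∈ component f a := by
  simp only [mem_component]
  exact ⟨fun h => h.trans (Linked.apply b).symm, fun h => h.trans (Linked.apply b)⟩

theorem Linked.component_eq (h : Linked f a b) : component f a = component f b := by
  ext z
  simp only [mem_component]
  exact ⟨h.symm.trans, h.trans⟩

theorem orbitPrefix_subset_component [DecidableEq R] (hb : b ∈ component f a) (n : ℕ) :
    orbitPrefix f b n ⊆ component f a := by
  intro z hz
  obtain ⟨i, -, rfl⟩ := mem_orbitPrefix.1 hz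
  exact mem_component.2 ((mem_component.1 hb).trans (Linked.iterate b i))

end Component

end Linked

/-! ### Networks of walks -/

/-- Robots `z` with base points `base z`, times `time z`, and windows `window z` to cover. Each
robot is linked to the robot `next z` by a walk through its window, whose length is at most `1` plus
the difference of the times. -/
structure Network (R E : Type*) [MetricSpace E] where
  next : R → R
  time : R → ℝ
  base : R → E
  window : R → Set E
  edge : ∀ z, Walk (base z) (base (next z)) (window z) (1 + time (next z) - time z)

namespace Network

variable {R E : Type*} [MetricSpace E] (N : Network R E)

/-- The points on the link of `z` to `next z`, with its ends. -/
def link (z : R) : Set E := insert (N.base z) (insert (N.base (N.next z)) (N.window z))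

/-- The points on the links of the robots in `A`. -/
def links (A : Finset R) : Set E := ⋃ z ∈ A, N.link z

/-- The increase of the time along the link of `z`. -/
def rise (z : R) : ℝ := N.time (N.next z) - N.time z

open Classical in
/-- The length of a closed walk along the link of `z`, which needs to be traversed only once if it
is a loop. -/
noncomputable def roundTrip (z : R) : ℝ := if N.next z = z then 1 else 2 * (1 + N.rise z)

theorem base_mem_link (z : R) : N.base z ∈ N.link z := Set.mem_insert _ _

theorem base_next_mem_link (z : R) : N.base (N.next z) ∈ N.link z :=
  Set.mem_insert_of_mem _ (Set.mem_insert _ _)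

theorem window_subset_link (z : R) : N.window z ⊆ N.link z :=
  (Set.subset_insert _ _).trans (Set.subset_insert _ _)

theorem link_subset_links {A : Finset R} {z : R} (hz : z ∈ A) : N.link z ⊆ N.links A :=
  Set.subset_biUnion_of_mem (u := N.link) hz

theorem links_insert [DecidableEq R] (z : R) (A : Finset R) :
    N.links (insert z A) = N.link z ∪ N.links A :=
  Finset.set_biUnion_insert z A N.link

theorem links_union [DecidableEq R] (A B : Finset R) :
    N.links (A ∪ B) = N.links A ∪ N.links B :=
  Finset.set_biUnion_union A B N.link

theorem walk_roundTrip (z : R) : Walk (N.base z) (N.base z) (N.link z) (N.roundTrip z) := by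
  have hedge := N.edge z
  by_cases hz : N.next z = z
  · have hloop := hedge.insert_right.insert_left
    rw [hz, add_sub_cancel_right] at hloop
    simpa only [link, roundTrip, hz, if_true] using hloop
  · simpa only [link, roundTrip, hz, if_false, rise, add_sub_assoc] using hedge.double

theorem roundTrip_le (z : R) : N.roundTrip z ≤ 2 * (1 + N.rise z) := by
  unfold roundTrip rise
  split_ifs with hz
  · norm_num [hz]
  · rfl

theorem roundTrip_of_fixed {r : R} (hr : N.next r = r) :
    N.roundTrip r = 2 * (1 + N.rise r) - 1 := by
  norm_num [roundTrip, rise, hr]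

theorem walk_iterate [DecidableEq R] (z : R) (n : ℕ) :
    Walk (N.base z) (N.base (N.next^[n] z)) (insert (N.base z) (N.links (orbitPrefix N.next z n)))
      (n + N.time (N.next^[n] z) - N.time z) := by
  induction n with
  | zero => exact (Walk.refl _).mono (by simp [links, orbitPrefix]) (by simp)
  | succ n ih =>
    have hedge := (N.edge (N.next^[n] z)).insert_right.insert_left
    rw [← Function.iterate_succ_apply' N.next n z] at hedge
    refine (ih.append hedge).mono ?_ (by push_cast; linarith)
    rw [orbitPrefix_succ, links_insert, link, ← Function.iterate_succ_apply' N.next n z]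
    intro s
    simp only [Set.mem_insert_iff, Set.mem_union]
    tauto

theorem sum_roundTrip_le (K : Finset R) :
    ∑ z ∈ K, N.roundTrip z ≤ 2 * #K + 2 * ∑ z ∈ K, N.rise z :=
  calc ∑ z ∈ K, N.roundTrip z
    _ ≤ ∑ z ∈ K, 2 * (1 + N.rise z) := Finset.sum_le_sum fun z _ => N.roundTrip_le z
    _ = 2 * #K + 2 * ∑ z ∈ K, N.rise z := by
      rw [← Finset.mul_sum, Finset.sum_add_distrib, Finset.sum_const, nsmul_one, mul_add]

theorem sum_roundTrip_le_of_fixed {r : R} {K : Finset R} (hr : N.next r = r) (hrK : r ∈ K) :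
    ∑ z ∈ K, N.roundTrip z ≤ 2 * #K - 1 + 2 * ∑ z ∈ K, N.rise z := by
  classical
  have hrest := N.sum_roundTrip_le (K.erase r)
  have hcard : (#(K.erase r) : ℝ) = #K - 1 := Finset.cast_card_erase_of_mem hrK
  rw [← Finset.add_sum_erase _ _ hrK, ← Finset.add_sum_erase K N.rise hrK, N.roundTrip_of_fixed hr]
  linarith

section Component

variable [Fintype R] {S : Set E} {ℓ : ℝ}

theorem exists_adjacent_link [DecidableEq R] {a : R} {A : Finset R} (hA : N.links A ⊆ S)
    (hS : ∃ z ∈ component N.next a, N.base z ∈ S) (hne : (component N.next a \ A).Nonempty) :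
    ∃ z ∈ component N.next a \ A, (N.link z ∩ S).Nonempty := by
  by_contra! hno
  obtain ⟨b, hb, hbS⟩ := hS
  obtain ⟨z₀, hz₀⟩ := hne
  have hzK := (Finset.mem_sdiff.1 hz₀).1
  simp only [mem_component] at hb hzK
  have hnotMem : ∀ z ∈ component N.next a \ A, ∀ x ∈ N.link z, x ∉ S := fun z hz x hx hxS =>
    (hno z hz).subset ⟨hx, hxS⟩
  have hiff : N.base b ∈ S ↔ N.base z₀ ∈ S := by
    refine Linked.iff_of_forall_apply (f := N.next) (p := fun z => N.base z ∈ S)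
      (hb.symm.trans hzK) fun z hz => ?_
    by_cases hzA : z ∈ A
    · have hlink := (N.link_subset_links hzA).trans hA
      exact iff_of_true (hlink (N.base_mem_link z)) (hlink (N.base_next_mem_link z))
    · have hzKA := Finset.mem_sdiff.2 ⟨mem_component.2 (hb.trans hz), hzA⟩
      exact iff_of_false (hnotMem z hzKA _ (N.base_mem_link z))
        (hnotMem z hzKA _ (N.base_next_mem_link z))
  exact hnotMem z₀ hz₀ _ (N.base_mem_link z₀) (hiff.1 hbS)

theorem walk_union_links [DecidableEq R] {a : R} {y : E} (A : Finset R) (hA : N.links A ⊆ S)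
    (hS : ∃ z ∈ component N.next a, N.base z ∈ S) (hw : Walk y y S ℓ) :
    Walk y y (S ∪ N.links (component N.next a))
      (ℓ + ∑ z ∈ component N.next a \ A, N.roundTrip z) := by
  induction hn : #(component N.next a \ A) generalizing A S ℓ with
  | zero =>
    rw [Finset.card_eq_zero] at hn
    have hK : N.links (component N.next a) ⊆ S :=
      (Set.biUnion_subset_biUnion_left (Finset.sdiff_eq_empty_iff_subset.1 hn)).trans hA
    rwa [hn, Finset.sum_empty, add_zero, Set.union_eq_left.2 hK]
  | succ n ih =>
    obtain ⟨z, hz, x, hxz, hxS⟩ :=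
      N.exists_adjacent_link hA hS (Finset.card_pos.1 (hn ▸ n.succ_pos))
    have hsdiff : component N.next a \ insert z A = (component N.next a \ A).erase z :=
      Finset.sdiff_insert _ _ _
    have hrest := ih (insert z A) (S := S ∪ N.link z)
      (by rw [links_insert, Set.union_comm]; exact Set.union_subset_union_left _ hA)
      (hS.imp fun _ => And.imp_right (Or.inl ·)) (hw.merge (N.walk_roundTrip z) hxS hxz)
      (by rw [hsdiff, Finset.card_erase_of_mem hz, hn, Nat.add_sub_cancel])
    refine hrest.mono (Set.union_subset_union_left _ Set.subset_union_left) (le_of_eq ?_)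
    rw [hsdiff, ← Finset.add_sum_erase _ _ hz, add_assoc]

theorem walk_component {a : R} {y : E} {A : Finset R} (hAK : A ⊆ component N.next a)
    (hA : N.links A ⊆ S) (hS : ∃ z ∈ component N.next a, N.base z ∈ S) (hw : Walk y y S ℓ) :
    Walk y y (S ∪ N.links (component N.next a))
      (ℓ + 2 * (#(component N.next a) - #A) +
        2 * (∑ z ∈ component N.next a, N.rise z - ∑ z ∈ A, N.rise z)) := by
  classical
  refine (N.walk_union_links A hA hS hw).mono subset_rfl ?_
  have hsum := N.sum_roundTrip_le (component N.next a \ A)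
  rw [Finset.cast_card_sdiff hAK, Finset.sum_sdiff_eq_sub (f := N.rise) hAK] at hsum
  linarith

theorem walk_component_of_fixed {a r : R} {y : E} {A : Finset R} (hr : N.next r = r)
    (har : Linked N.next a r) (hrA : r ∉ A) (hAK : A ⊆ component N.next a) (hA : N.links A ⊆ S)
    (hS : ∃ z ∈ component N.next a, N.base z ∈ S) (hw : Walk y y S ℓ) :
    Walk y y (S ∪ N.links (component N.next a))
      (ℓ + 2 * (#(component N.next a) - #A) - 1 +
        2 * (∑ z ∈ component N.next a, N.rise z - ∑ z ∈ A, N.rise z)) := by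
  classical
  refine (N.walk_union_links A hA hS hw).mono subset_rfl ?_
  have hsum := N.sum_roundTrip_le_of_fixed hr
    (Finset.mem_sdiff.2 ⟨mem_component.2 har, hrA⟩ : r ∈ component N.next a \ A)
  rw [Finset.cast_card_sdiff hAK, Finset.sum_sdiff_eq_sub (f := N.rise) hAK] at hsum
  linarith

end Component

/-- Times are nonnegative, and at most one link leads to a robot whose time is positive. Hence the
times of the targets of distinct links sum up to at most the times of the robots. -/
structure IsBalanced : Prop where
  time_nonneg : ∀ z, 0 ≤ N.time z
  eq_of_next_eq : ∀ a b, N.next a = N.next b → 0 < N.time (N.next a) → a = b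

namespace IsBalanced

variable {N} (hN : N.IsBalanced)

include hN

theorem sum_time_next_le {S S' : Finset R} (h : ∀ z ∈ S, N.next z ∈ S') :
    ∑ z ∈ S, N.time (N.next z) ≤ ∑ z ∈ S', N.time z := by
  classical
  calc ∑ z ∈ S, N.time (N.next z)
    _ = ∑ z ∈ S with 0 < N.time (N.next z), N.time (N.next z) :=
      (Finset.sum_filter_of_ne fun z _ hz => (hN.time_nonneg _).lt_of_ne' hz).symm
    _ = ∑ w ∈ {z ∈ S | 0 < N.time (N.next z)}.image N.next, N.time w :=
      (Finset.sum_image fun a ha b _ hab =>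
        hN.eq_of_next_eq a b hab (Finset.mem_filter.1 ha).2).symm
    _ ≤ ∑ z ∈ S', N.time z := by
      refine Finset.sum_le_sum_of_subset_of_nonneg ?_ fun _ _ _ => hN.time_nonneg _
      intro w hw
      obtain ⟨z, hz, rfl⟩ := Finset.mem_image.1 hw
      exact h z (Finset.mem_filter.1 hz).1

variable [Fintype R]

theorem sum_rise_component_nonpos (a : R) : ∑ z ∈ component N.next a, N.rise z ≤ 0 := by
  simp only [rise, Finset.sum_sub_distrib, sub_nonpos]
  exact hN.sum_time_next_le fun _ => apply_mem_component.2

theorem sum_rise_component_le_of_leaf {j : R} (hleaf : ∀ z, N.next z ≠ j) :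
    ∑ z ∈ component N.next j, N.rise z ≤ -N.time j := by
  classical
  have hsum := hN.sum_time_next_le (S := component N.next j) (S' := (component N.next j).erase j)
    fun z hz => Finset.mem_erase.2 ⟨hleaf z, apply_mem_component.2 hz⟩
  simp only [rise, Finset.sum_sub_distrib]
  linarith [Finset.add_sum_erase _ N.time (self_mem_component (f := N.next) j)]

theorem walk_component_of_cycle {a : R} (ha : 2 ≤ Function.minimalPeriod N.next a) :
    Walk (N.base a) (N.base a) (N.links (component N.next a)) (2 * #(component N.next a) - 2) := by
  classical
  set c := Function.minimalPeriod N.next a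
  have hca : N.next^[c] a = a := Function.iterate_minimalPeriod
  have hinj : Set.InjOn (fun i => N.next^[i] a) (Set.Iio c) :=
    Function.iterate_injOn_Iio_minimalPeriod
  have hcycle := N.walk_iterate a c
  have hrise : ∑ z ∈ orbitPrefix N.next a c, N.rise z = _ := sum_orbitPrefix_sub N.time hinj
  rw [hca] at hcycle hrise
  refine (N.walk_component (orbitPrefix_subset_component (self_mem_component a) c)
    (Set.subset_insert _ _) ⟨a, self_mem_component a, Set.mem_insert _ _⟩ hcycle).mono
    Set.subset_union_right ?_
  have hc : (2 : ℝ) ≤ c := by exact_mod_cast ha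
  rw [card_orbitPrefix hinj, hrise]
  linarith [hN.sum_rise_component_nonpos a]

theorem walk_component_of_fixed {a r : R} (hr : N.next r = r) (har : Linked N.next a r) :
    Walk (N.base r) (N.base r) (N.links (component N.next a)) (2 * #(component N.next a) - 1) := by
  classical
  have hempty : N.links ∅ ⊆ {N.base r} := by simp [links]
  refine (N.walk_component_of_fixed hr har (Finset.notMem_empty r) (Finset.empty_subset _) hempty
    ⟨r, mem_component.2 har, rfl⟩ (Walk.refl _)).mono Set.subset_union_right ?_
  simp only [Finset.card_empty, Finset.sum_empty]
  linarith [hN.sum_rise_component_nonpos a]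

theorem exists_walk_component (a : R) :
    (∃ y, Walk y y (N.links (component N.next a)) (2 * #(component N.next a) - 2)) ∨
      ∃ r, N.next r = r ∧ Linked N.next a r ∧
        Walk (N.base r) (N.base r) (N.links (component N.next a))
          (2 * #(component N.next a) - 1) := by
  obtain ⟨i, hi⟩ := exists_minimalPeriod_pos N.next a
  have hlinked := Linked.iterate (f := N.next) a i
  by_cases hfix : N.next (N.next^[i] a) = N.next^[i] a
  · exact .inr ⟨_, hfix, hlinked, hN.walk_component_of_fixed hfix hlinked⟩
  · have hper : Function.minimalPeriod N.next (N.next^[i] a) ≠ 1 := fun h =>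
      hfix (Function.minimalPeriod_eq_one_iff_isFixedPt.1 h)
    rw [hlinked.component_eq]
    exact .inl ⟨_, hN.walk_component_of_cycle (by omega)⟩

section Link

variable {r j q : R} {S : Set E} {ℓ : ℝ}

theorem walk_component_of_link_iterate (hr : N.next r = r) (hjr : Linked N.next j r)
    (hleaf : ∀ z, N.next z ≠ j) {n : ℕ} (hn : ∀ i < n, N.next^[i] j ≠ N.next^[n] j)
    (hlink : Walk (N.base j) (N.base (N.next^[n] j)) S ℓ) :
    Walk (N.base j) (N.base j) (S ∪ N.links (component N.next j))
      (ℓ + 2 * #(component N.next j) - 1 - n - N.time (N.next^[n] j) - N.time j) := by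
  classical
  have hinj := injOn_iterate_of_forall_ne hn
  refine (N.walk_component_of_fixed hr hjr (notMem_orbitPrefix_of_fixed hr hn)
    (orbitPrefix_subset_component (self_mem_component j) n)
    ((Set.subset_insert _ _).trans Set.subset_union_right)
    ⟨j, self_mem_component j, .inr (Set.mem_insert _ _)⟩
    (hlink.append (N.walk_iterate j n).reverse)).mono
    (Set.union_subset_union_left _ Set.subset_union_left) ?_
  have hrise : ∑ z ∈ orbitPrefix N.next j n, N.rise z = _ := sum_orbitPrefix_sub N.time hinj
  rw [card_orbitPrefix hinj, hrise]
  linarith [hN.sum_rise_component_le_of_leaf hleaf]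

theorem walk_component_of_link_of_forall_ne (hr : N.next r = r) (hjr : Linked N.next j r)
    (hleaf : ∀ z, N.next z ≠ j) (hjq : Linked N.next j q) (hq : ∀ n, N.next^[n] j ≠ q)
    (hlink : Walk (N.base j) (N.base q) S ℓ) :
    Walk (N.base j) (N.base j) (S ∪ N.links (component N.next j))
      (ℓ + 2 * #(component N.next j) - 3 + N.time q - N.time j) := by
  classical
  obtain ⟨n, m, hmeet, hn, hm⟩ := hjq.exists_first_meeting
  have hnj : ∀ i < n, N.next^[i] j ≠ N.next^[n] j := fun i hi => hmeet ▸ hn i hi m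
  have hdisj : Disjoint (orbitPrefix N.next j n) (orbitPrefix N.next q m) := by
    simp only [Finset.disjoint_left, mem_orbitPrefix]
    rintro _ ⟨i, hi, rfl⟩ ⟨i', -, hi'⟩
    exact hn i hi i' hi'.symm
  have hn_pos : n ≠ 0 := by
    rintro rfl
    cases m with
    | zero => exact hq 0 hmeet
    | succ m => exact hleaf _ ((Function.iterate_succ_apply' N.next m q).symm.trans hmeet.symm)
  have hm_pos : m ≠ 0 := by
    rintro rfl
    exact hq n hmeet
  have hpath := (hlink.append (N.walk_iterate q m)).append (hmeet ▸ N.walk_iterate j n).reverse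
  refine (N.walk_component_of_fixed hr hjr (A := orbitPrefix N.next j n ∪ orbitPrefix N.next q m)
    ?_ ?_ ?_ ⟨j, self_mem_component j, .inr (Set.mem_insert _ _)⟩ hpath).mono ?_ ?_
  · rw [Finset.mem_union, not_or]
    exact ⟨notMem_orbitPrefix_of_fixed hr hnj, notMem_orbitPrefix_of_fixed hr hm⟩
  · exact Finset.union_subset (orbitPrefix_subset_component (self_mem_component j) n)
      (orbitPrefix_subset_component (mem_component.2 hjq) m)
  · rw [links_union, Set.union_comm]
    exact Set.union_subset_union ((Set.subset_insert _ _).trans Set.subset_union_right)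
      (Set.subset_insert _ _)
  · exact Set.union_subset_union_left _ (Set.subset_union_left.trans Set.subset_union_left)
  · have hinj := injOn_iterate_of_forall_ne hnj
    have hinj' := injOn_iterate_of_forall_ne hm
    have hrise : ∑ z ∈ orbitPrefix N.next j n, N.rise z = _ := sum_orbitPrefix_sub N.time hinj
    have hrise' : ∑ z ∈ orbitPrefix N.next q m, N.rise z = _ := sum_orbitPrefix_sub N.time hinj'
    rw [Finset.card_union_of_disjoint hdisj, Finset.sum_union hdisj, hrise, hrise',
      card_orbitPrefix hinj, card_orbitPrefix hinj', hmeet]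
    push_cast
    have hn_one : (1 : ℝ) ≤ n := by exact_mod_cast Nat.one_le_iff_ne_zero.2 hn_pos
    have hm_one : (1 : ℝ) ≤ m := by exact_mod_cast Nat.one_le_iff_ne_zero.2 hm_pos
    linarith [hN.sum_rise_component_le_of_leaf hleaf, hN.time_nonneg (N.next^[m] q)]

theorem walk_component_of_link_fixed (hr : N.next r = r) (hjr : Linked N.next j r)
    (hleaf : ∀ z, N.next z ≠ j) (hlink : Walk (N.base j) (N.base r) S ℓ) (hS : N.window r ⊆ S) :
    Walk (N.base j) (N.base j) (S ∪ N.links (component N.next j))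
      (ℓ + 2 * #(component N.next j) - 3 - N.time r - N.time j) := by
  classical
  obtain ⟨n, hn, hmin⟩ : ∃ n, N.next^[n] j = r ∧ ∀ i < n, N.next^[i] j ≠ r :=
    have hex := hjr.exists_iterate_eq hr
    ⟨Nat.find hex, Nat.find_spec hex, fun _ => Nat.find_min hex⟩
  have hn_pos : n ≠ 0 := fun h0 => hleaf r (by rw [hr, ← hn, h0, Function.iterate_zero_apply])
  subst hn
  set r := N.next^[n] j
  have hinj := injOn_iterate_of_forall_ne hmin
  have hrn : r ∉ orbitPrefix N.next j n := notMem_orbitPrefix_of_fixed hr hmin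
  refine (N.walk_component (A := insert r (orbitPrefix N.next j n)) (Finset.insert_subset
    (mem_component.2 hjr) (orbitPrefix_subset_component (self_mem_component j) n)) ?_
    ⟨j, self_mem_component j, .inr (Set.mem_insert _ _)⟩
    (hlink.insert_right.append (N.walk_iterate j n).reverse)).mono
    (Set.union_subset_union_left _ ((Set.subset_insert _ _).trans Set.subset_union_left)) ?_
  · rw [links_insert]
    refine Set.union_subset_union ?_ (Set.subset_insert _ _)
    rw [link, hr, Set.insert_idem]
    exact Set.insert_subset_insert hS
  · have hrise : ∑ z ∈ orbitPrefix N.next j n, N.rise z = _ := sum_orbitPrefix_sub N.time hinj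
    rw [Finset.sum_insert hrn, Finset.card_insert_of_notMem hrn, card_orbitPrefix hinj, hrise,
      rise, hr]
    push_cast
    have hn_one : (1 : ℝ) ≤ n := by exact_mod_cast Nat.one_le_iff_ne_zero.2 hn_pos
    linarith [hN.sum_rise_component_le_of_leaf hleaf]

end Link

end IsBalanced

end Network

/-! ### Configurations of time windows -/

/-- Trajectories of robots of maximum speed one in a metric space that contains the sites, with
finitely many visits, which leave no site unvisited for a whole unit of time around time `0`. -/
structure PatrolRecord (R P E : Type*) [MetricSpace E] where
  pos : R → ℝ → E
  dist_pos_le : ∀ z s t, dist (pos z s) (pos z t) ≤ |s - t|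
  point : P → E
  visits : Set (R × P × ℝ)
  finite_visits : visits.Finite
  pos_eq : ∀ {z p t}, (z, p, t) ∈ visits → pos z t = point p
  forward : ∀ p t, 0 ≤ t → t ≤ 1 / 2 → ∃ z w, (z, p, w) ∈ visits ∧ t < w ∧ w ≤ t + 1
  backward : ∀ p t, 0 < t → t ≤ 1 → ∃ z w, (z, p, w) ∈ visits ∧ t - 1 ≤ w ∧ w < t

/-- A partition of the robots into groups, and an assignment of the sites to the groups through
one robot for each site. -/
@[ext]
structure Grouping (R P : Type*) where
  setoid : Setoid R
  robotOf : P → R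

namespace Grouping

variable {R P : Type*} (g : Grouping R P)

/-- The sites assigned to the group of `z`. -/
def sites (z : R) : Set P := {p | g.setoid (g.robotOf p) z}

open Classical in
/-- The robots in the group of `z`. -/
noncomputable def robots [Fintype R] (z : R) : Finset R := {a | g.setoid a z}

end Grouping

/-- The robots can be divided into groups, and the sites among the groups, such that each group
has a closed walk through its sites of length at most `2 - 2 / k` times the number of its robots. -/
def PatrolRecord.HasGrouping {R P E : Type*} [MetricSpace E] [Fintype R]
    (D : PatrolRecord R P E) : Prop :=
  ∃ g : Grouping R P, ∀ z, ∃ y,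
    Walk y y (D.point '' g.sites z) ((2 - 2 / Fintype.card R) * #(g.robots z))

/-- Each robot `z` has a time window `[start z, finish z]`, and these windows cover all the sites.
The site of `z` at the end of its window is visited by its parent at the time `meet z`.
The robots in `loops` have a closed walk of length `1` through their window. -/
structure Config {R P E : Type*} [MetricSpace E] [DecidableEq R] (D : PatrolRecord R P E) where
  start : R → ℝ
  finish : R → ℝ
  meet : R → ℝ
  parent : R → R
  loops : Finset R
  start_nonneg : ∀ z, 0 ≤ start z
  start_le_half : ∀ z, start z ≤ 1 / 2
  start_le_finish : ∀ z, start z ≤ finish z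
  meet_le : ∀ z, meet z ≤ start (parent z)
  finish_le : ∀ z, finish z ≤ meet z + 1
  pos_meet : ∀ z, D.pos (parent z) (meet z) = D.pos z (finish z)
  covers : ∀ p, ∃ z t, (z, p, t) ∈ D.visits ∧ t ∈ Set.Icc (start z) (finish z)
  loop : ∀ q ∈ loops, Walk (D.pos q (start q)) (D.pos q (start q))
    (D.pos q '' Set.Icc (start q) (finish q)) 1
  eq_of_next_mem_loops : ∀ q ∈ loops, ∀ z, loops.piecewise id parent z = q → z = q
  eq_of_next_eq : ∀ a b, loops.piecewise id parent a = loops.piecewise id parent b →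
    0 < start (loops.piecewise id parent a) → a = b

namespace Config

variable {R P E : Type*} [MetricSpace E] [DecidableEq R] {D : PatrolRecord R P E} (c : Config D)

/-- A robot in `loops` is linked to itself, any other robot to its parent. -/
abbrev next : R → R := c.loops.piecewise id c.parent

theorem next_of_mem {z : R} (h : z ∈ c.loops) : c.next z = z := by simp [next, h]

theorem next_of_notMem {z : R} (h : z ∉ c.loops) : c.next z = c.parent z := by simp [next, h]

/-- The position of the robot `z` at the start of its window. -/
def base (z : R) : E := D.pos z (c.start z)

/-- The points that the robot `z` passes during its window. -/
def window (z : R) : Set E := D.pos z '' Set.Icc (c.start z) (c.finish z)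

theorem walk_parent (z : R) {w : ℝ} (hw : w ≤ c.start z) :
    Walk (D.pos z w) (c.base (c.parent z)) (c.window z) (1 + c.start (c.parent z) - w) := by
  have hown := Walk.of_lipschitz (D.dist_pos_le z) (hw.trans (c.start_le_finish z))
  rw [← c.pos_meet z] at hown
  refine (hown.append (Walk.of_lipschitz (D.dist_pos_le (c.parent z)) (c.meet_le z))).mono ?_
    (by linarith [c.finish_le z])
  exact (Set.image_mono (Set.Icc_subset_Icc_left hw)).trans Set.subset_union_left

/-- The walk follows the robot `i` backwards from a visit after its window. -/
theorem walk_of_later {j i : R} {w : ℝ} (hw : c.finish i < w) (hpos : D.pos i w = c.base j) :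
    Walk (c.base j) (c.base i) (c.window i) (w - c.start i) := by
  have hown := Walk.of_lipschitz (D.dist_pos_le i) ((c.start_le_finish i).trans hw.le)
  rw [hpos] at hown
  exact (hown.mono (Set.image_mono (Set.Icc_subset_Icc_right hw.le)) le_rfl).reverse

/-- The network of the links to the next robots. -/
def network : Network R E where
  next := c.next
  time := c.start
  base := c.base
  window := c.window
  edge z := by
    by_cases h : z ∈ c.loops
    · rw [c.next_of_mem h]
      exact (c.loop z h).mono subset_rfl (by linarith)
    · rw [c.next_of_notMem h]
      exact c.walk_parent z le_rfl

theorem window_subset_links {z : R} {A : Finset R} (hz : z ∈ A) :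
    c.window z ⊆ c.network.links A :=
  (c.network.window_subset_link z).trans (c.network.link_subset_links hz)

theorem isBalanced_network : c.network.IsBalanced := ⟨c.start_nonneg, c.eq_of_next_eq⟩

/-- The network of the links to the parents. -/
def parentNetwork : Network R E where
  next := c.parent
  time := c.start
  base := c.base
  window := c.window
  edge z := c.walk_parent z le_rfl

theorem eq_of_linked_of_mem_loops {q z : R} (hq : q ∈ c.loops) (h : Linked c.next z q) : z = q := by
  obtain ⟨n, hn⟩ := h.exists_iterate_eq (c.next_of_mem hq)
  induction n with
  | zero => exact hn
  | succ n ih =>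
    rw [Function.iterate_succ_apply'] at hn
    exact ih (c.eq_of_next_mem_loops q hq _ hn)

theorem window_subset_parentLinks {z : R} {A : Finset R} (hz : z ∈ A) :
    c.window z ⊆ c.parentNetwork.links A :=
  (c.parentNetwork.window_subset_link z).trans (c.parentNetwork.link_subset_links hz)

variable [Fintype R]

theorem component_of_mem_loops {q : R} (hq : q ∈ c.loops) : component c.next q = {q} :=
  Finset.eq_singleton_iff_unique_mem.2 ⟨self_mem_component q, fun _ hz =>
    c.eq_of_linked_of_mem_loops hq (mem_component.1 hz).symm⟩

theorem hasGrouping_of_group (group : R → Finset R)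
    (hgroup : ∀ a z, a ∈ group z ↔ group a = group z)
    (hwalk : ∀ z, ∃ y S, (∀ a ∈ group z, c.window a ⊆ S) ∧
      Walk y y S ((2 - 2 / Fintype.card R) * #(group z))) :
    D.HasGrouping := by
  choose robotOf time hvisit htime using c.covers
  refine ⟨⟨Setoid.ker group, robotOf⟩, fun z => ?_⟩
  obtain ⟨y, S, hS, hw⟩ := hwalk z
  have hrobots : Grouping.robots ⟨Setoid.ker group, robotOf⟩ z = group z := by
    ext a
    simp [Grouping.robots, Setoid.ker_def, hgroup]
  rw [hrobots]
  refine ⟨y, hw.mono ?_ le_rfl⟩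
  rintro _ ⟨p, hp, rfl⟩
  exact hS (robotOf p) ((hgroup _ _).2 hp) ⟨time p, htime p, D.pos_eq (hvisit p)⟩

omit [DecidableEq R] in
theorem two_mul_card_sub_two_le (K : Finset R) :
    2 * (#K : ℝ) - 2 ≤ (2 - 2 / Fintype.card R) * #K := by
  have hK : (#K : ℝ) ≤ Fintype.card R := by exact_mod_cast K.card_le_univ
  have hle : 2 / (Fintype.card R : ℝ) * #K ≤ 2 := by
    rw [div_mul_eq_mul_div]
    exact div_le_of_le_mul₀ (Nat.cast_nonneg _) zero_le_two (by linarith)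
  linarith

omit [DecidableEq R] in
theorem two_mul_card_sub_one_le {K : Finset R} (hK : 2 * #K ≤ Fintype.card R) :
    2 * (#K : ℝ) - 1 ≤ (2 - 2 / Fintype.card R) * #K := by
  have hK' : 2 * (#K : ℝ) ≤ Fintype.card R := by exact_mod_cast hK
  have hle : 2 / (Fintype.card R : ℝ) * #K ≤ 1 := by
    rw [div_mul_eq_mul_div]
    exact div_le_of_le_mul₀ (Nat.cast_nonneg _) zero_le_one (by linarith)
  linarith

theorem exists_walk_component (a : R)
    (hsmall : ∀ o, c.next o = o → Linked c.next a o →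
      2 * #(component c.next a) ≤ Fintype.card R) :
    ∃ y S, (∀ z ∈ component c.next a, c.window z ⊆ S) ∧
      Walk y y S ((2 - 2 / Fintype.card R) * #(component c.next a)) := by
  have hwindow : ∀ z ∈ component c.next a, c.window z ⊆ c.network.links (component c.next a) :=
    fun _ => c.window_subset_links
  rcases c.isBalanced_network.exists_walk_component a with ⟨y, hw⟩ | ⟨o, ho, hao, hw⟩
  · exact ⟨y, _, hwindow, hw.mono subset_rfl (two_mul_card_sub_two_le _)⟩
  · exact ⟨_, _, hwindow, hw.mono subset_rfl (two_mul_card_sub_one_le (hsmall o ho hao))⟩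

/-- The robots in `M` form one group, and each of the remaining components is a group. -/
theorem hasGrouping [Nontrivial R] (M : Finset R) (hM : ∀ z, c.next z ∈ M ↔ z ∈ M)
    (hwalk : M.Nonempty → ∃ y S, (∀ z ∈ M, c.window z ⊆ S) ∧ Walk y y S (2 * #M - 2))
    (hsmall : ∀ o, c.next o = o → o ∉ M → o ∉ c.loops →
      2 * #(component c.next o) ≤ Fintype.card R) :
    D.HasGrouping := by
  have hlinked : ∀ {a z}, Linked c.next a z → (a ∈ M ↔ z ∈ M) := fun h =>
    h.iff_of_forall_apply (p := (· ∈ M)) fun z _ => (hM z).symm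
  refine c.hasGrouping_of_group (fun z => if z ∈ M then M else component c.next z)
    (fun a z => ?_) fun z => ?_
  · by_cases hz : z ∈ M <;> by_cases ha : a ∈ M <;>
      simp only [hz, ha, if_true, if_false, false_iff, mem_component]
    · exact fun h => ha (h ▸ self_mem_component a)
    · exact iff_of_false (fun h => hz ((hlinked h).2 ha))
        fun h => hz (h ▸ self_mem_component z)
    · exact ⟨fun h => h.component_eq.symm, fun h => mem_component.1 (h ▸ self_mem_component a)⟩
  · by_cases hz : z ∈ M <;> simp only [hz, if_true, if_false]
    · obtain ⟨y, S, hS, hw⟩ := hwalk ⟨z, hz⟩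
      exact ⟨y, S, hS, hw.mono subset_rfl (two_mul_card_sub_two_le M)⟩
    · refine c.exists_walk_component z fun o ho hzo => ?_
      rw [hzo.component_eq]
      by_cases hol : o ∈ c.loops
      · rw [c.component_of_mem_loops hol, Finset.card_singleton]
        exact Fintype.one_lt_card
      · exact hsmall o ho (mt (hlinked hzo).2 hz) hol

end Config

namespace Config

variable {R P E : Type*} [MetricSpace E] [DecidableEq R] {D : PatrolRecord R P E} {c : Config D}
  {r : R}

/-! ### Rooted configurations -/

/-- The robots of the components with a self-link that neither belongs to the root `r` nor to a
robot in `loops`. -/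
def idle (c : Config D) (r : R) : Set R :=
  {z | ∃ o, c.next o = o ∧ o ≠ r ∧ o ∉ c.loops ∧ Linked c.next z o}

/-- All components with a self-link, except the one of the root `r`, are small. The robots in their
components have not been used yet: their windows start at time `0`, and they are not the parents of
robots in `loops`, nor do the parents lead around in `loops` forever. -/
structure IsRooted [Fintype R] (c : Config D) (r : R) : Prop where
  parent_root : c.parent r = r
  start_root : c.start r = 0
  root_notMem : r ∉ c.loops
  small : ∀ z ∈ c.idle r, 2 * #(component c.next z) ≤ Fintype.card R
  start_eq_zero : ∀ z ∈ c.idle r, c.start z = 0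
  parent_notMem : ∀ q ∈ c.loops, c.parent q ∉ c.idle r
  exits : ∀ q, ∃ n, c.parent^[n] q ∉ c.loops

theorem next_mem_iff_of_subset_loops {N : Finset R} (hN : N ⊆ c.loops) (z : R) :
    c.next z ∈ N ↔ z ∈ N := by
  refine ⟨fun h => ?_, fun h => by rwa [c.next_of_mem (hN h)]⟩
  have hz := c.eq_of_next_mem_loops _ (hN h) z rfl
  rwa [← hz] at h

variable [Fintype R]

theorem disjoint_component_of_subset_loops {N : Finset R} (hN : N ⊆ c.loops) {z : R}
    (hz : z ∉ c.loops) : Disjoint (component c.next z) N := by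
  refine Finset.disjoint_left.2 fun a ha haN => hz ?_
  rw [c.eq_of_linked_of_mem_loops (hN haN) (mem_component.1 ha)]
  exact hN haN

namespace IsRooted

variable (h : c.IsRooted r)

include h

theorem next_root : c.next r = r := by
  rw [c.next_of_notMem h.root_notMem, h.parent_root]

section Nontrivial

variable [Nontrivial R]

theorem hasGrouping_of_walk (M : Finset R) (hM : ∀ z, c.next z ∈ M ↔ z ∈ M) (hr : r ∈ M) {y : E}
    {S : Set E} (hS : ∀ z ∈ M, c.window z ⊆ S) (hw : Walk y y S (2 * #M - 2)) :
    D.HasGrouping :=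
  c.hasGrouping M hM (fun _ => ⟨y, S, hS, hw⟩) fun o ho hoM hol =>
    h.small o ⟨o, ho, fun e => hoM (e ▸ hr), hol, Linked.refl o⟩

theorem hasGrouping_of_small (hr : 2 * #(component c.next r) ≤ Fintype.card R) :
    D.HasGrouping :=
  c.hasGrouping ∅ (by simp) (by simp) fun o ho _ hol => by
    by_cases hor : o = r
    · rwa [hor]
    · exact h.small o ⟨o, ho, hor, hol, Linked.refl o⟩

theorem hasGrouping_of_component {a : R} (ha : Linked c.next a r) {S : Set E} {y : E}
    (hw : Walk y y (S ∪ c.network.links (component c.next a)) (2 * #(component c.next a) - 2)) :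
    D.HasGrouping := by
  rw [ha.component_eq] at hw
  exact h.hasGrouping_of_walk _ (fun _ => apply_mem_component) (self_mem_component r)
    (fun _ hz => (c.window_subset_links hz).trans Set.subset_union_right) hw

variable {j i : R} (hj : Linked c.next j r) (hleaf : ∀ z, c.next z ≠ j)

include hj hleaf

omit [Nontrivial R] in
theorem walk_component :
    Walk (c.base j) (c.base j) (insert (c.base j) (c.network.links (component c.next r)))
      (2 * #(component c.next r) - 1 - 2 * c.start j) := by
  rw [← hj.component_eq]
  refine (c.isBalanced_network.walk_component_of_link_iterate h.next_root hj hleaf (n := 0)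
    (by simp) (Walk.refl _)).mono subset_rfl (le_of_eq ?_)
  simp only [network, Function.iterate_zero, id_eq, Nat.cast_zero]
  ring

theorem hasGrouping_of_half_le (hs : 1 / 2 ≤ c.start j) : D.HasGrouping :=
  h.hasGrouping_of_component (Linked.refl r) (S := ∅)
    ((h.walk_component hj hleaf).mono (by simp) (by linarith))

theorem hasGrouping_of_root_later {w : ℝ} (hw : c.finish r < w) (hw' : w ≤ c.start j + 1)
    (hpos : D.pos r w = c.base j) : D.HasGrouping := by
  have hclosed := c.isBalanced_network.walk_component_of_link_fixed h.next_root hj hleaf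
    (c.walk_of_later hw hpos) subset_rfl
  refine h.hasGrouping_of_component hj (hclosed.mono subset_rfl ?_)
  simp only [network, h.start_root]
  linarith

omit [Nontrivial R] in
theorem walk_component_of_link {z : R} (hz : Linked c.next z r) {m : ℕ} (hjz : m ≠ 0 ∨ z ≠ j)
    {w : ℝ} (hw : c.start j < w) {S : Set E}
    (hlink : Walk (c.base j) (c.base z) S (m + c.start z - w)) :
    Walk (c.base j) (c.base j) (S ∪ c.network.links (component c.next r))
      (2 * (#(component c.next r) + m) - 2) := by
  rw [← hj.component_eq]
  have hj_nonneg := c.start_nonneg j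
  by_cases hreach : ∃ n, c.next^[n] j = z
  · obtain ⟨n, hn, hmin⟩ : ∃ n, c.next^[n] j = z ∧ ∀ i < n, c.next^[i] j ≠ z :=
      ⟨Nat.find hreach, Nat.find_spec hreach, fun _ => Nat.find_min hreach⟩
    subst hn
    have hmn : 1 ≤ m + n := by
      by_contra! hlt
      obtain ⟨rfl, rfl⟩ : m = 0 ∧ n = 0 := by omega
      exact hjz.elim (fun hne => hne rfl) fun hne => hne rfl
    have hmn' : (1 : ℝ) ≤ m + n := by exact_mod_cast hmn
    refine (c.isBalanced_network.walk_component_of_link_iterate h.next_root hj hleaf hmin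
      hlink).mono subset_rfl ?_
    simp only [network]
    linarith
  · push Not at hreach
    refine (c.isBalanced_network.walk_component_of_link_of_forall_ne h.next_root hj hleaf
      (hj.trans hz.symm) hreach hlink).mono subset_rfl ?_
    simp only [network]
    linarith [c.start_le_half z]

/-- The robots `N` in `loops` join the component of the root through a walk to one of its robots. -/
theorem hasGrouping_of_link {N : Finset R} {z : R} (hN : N ⊆ c.loops) (hz : Linked c.next z r)
    (hjz : N.Nonempty ∨ z ≠ j) {w : ℝ} (hw : c.start j < w)
    (hlink : Walk (c.base j) (c.base z) (c.parentNetwork.links N) (#N + c.start z - w)) :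
    D.HasGrouping := by
  refine h.hasGrouping_of_walk (component c.next r ∪ N) (fun a => ?_)
    (Finset.mem_union_left _ (self_mem_component r)) (fun a ha => ?_)
    ((h.walk_component_of_link hj hleaf hz (hjz.imp_left Finset.card_ne_zero.2) hw
      hlink).mono subset_rfl (le_of_eq ?_))
  · simp only [Finset.mem_union, apply_mem_component, next_mem_iff_of_subset_loops hN]
  · rcases Finset.mem_union.1 ha with ha | ha
    · exact (c.window_subset_links ha).trans Set.subset_union_right
    · exact (c.window_subset_parentLinks ha).trans Set.subset_union_left
  · rw [Finset.card_union_of_disjoint (disjoint_component_of_subset_loops hN h.root_notMem),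
      Nat.cast_add]

/-- The robots `N` in `loops` and the component of `z`, which contains a cycle, join the component
of the root. -/
theorem hasGrouping_of_link_of_notMem {N : Finset R} {z : R} (hN : N ⊆ c.loops)
    (hzl : z ∉ c.loops) (hzi : z ∉ c.idle r) (hzr : ¬ Linked c.next z r) {w : ℝ}
    (hw : c.start j < w)
    (hlink : Walk (c.base j) (c.base z) (c.parentNetwork.links N) (#N + c.start z - w)) :
    D.HasGrouping := by
  have hno_fixed : ∀ o, c.next o = o → ¬ Linked c.next z o := fun o ho hzo => by
    by_cases hol : o ∈ c.loops
    · exact hzl (c.eq_of_linked_of_mem_loops hol hzo ▸ hol)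
    · exact hzi ⟨o, ho, fun e => hzr (e ▸ hzo), hol, hzo⟩
  obtain ⟨y, hy⟩ | ⟨o, ho, hzo, -⟩ := c.isBalanced_network.exists_walk_component z
  swap
  · exact absurd hzo (hno_fixed o ho)
  have hclosed := ((h.walk_component hj hleaf).merge hlink.double (Set.mem_insert _ _)
    (Set.mem_insert _ _)).merge hy (.inr (.inr (Set.mem_insert _ _)))
    (c.network.link_subset_links (self_mem_component z) (c.network.base_mem_link z))
  have hdisj : Disjoint (component c.next r ∪ N) (component c.next z) := by
    refine Finset.disjoint_union_left.2 ⟨Finset.disjoint_left.2 fun a har haz => hzr ?_,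
      (disjoint_component_of_subset_loops hN hzl).symm⟩
    exact (mem_component.1 haz).trans (mem_component.1 har).symm
  refine h.hasGrouping_of_walk (component c.next r ∪ N ∪ component c.next z) (fun a => ?_)
    (Finset.mem_union_left _ (Finset.mem_union_left _ (self_mem_component r))) (fun a ha => ?_)
    (hclosed.mono subset_rfl ?_)
  · simp only [Finset.mem_union, apply_mem_component, next_mem_iff_of_subset_loops hN]
  · rcases Finset.mem_union.1 ha with ha | ha
    · rcases Finset.mem_union.1 ha with ha | ha
      · exact fun s hs => .inl (.inl (.inr (c.window_subset_links ha hs)))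
      · exact fun s hs => .inl (.inr (.inr (.inr (c.window_subset_parentLinks ha hs))))
    · exact fun s hs => .inr (c.window_subset_links ha hs)
  · rw [Finset.card_union_of_disjoint hdisj, Finset.card_union_of_disjoint
      (disjoint_component_of_subset_loops hN h.root_notMem)]
    push_cast
    simp only [network]
    linarith [c.start_nonneg j, c.start_le_half z]

omit hj hleaf [Nontrivial R] in
theorem exists_walk_of_notMem_idle (hi : i ∉ c.idle r) {w : ℝ} (hw : w ≤ c.start i) :
    ∃ N ⊆ c.loops, ∃ z ∉ c.loops, z ∉ c.idle r ∧ (N = ∅ → z = i) ∧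
      Walk (D.pos i w) (c.base z) (c.parentNetwork.links N) (#N + c.start z - w) := by
  classical
  have hex := h.exits i
  obtain ⟨n, hn, hmin⟩ : ∃ n, c.parent^[n] i ∉ c.loops ∧ ∀ m < n, c.parent^[m] i ∈ c.loops :=
    ⟨Nat.find hex, Nat.find_spec hex, fun _ hm => not_not.1 (Nat.find_min hex hm)⟩
  have hcard := card_orbitPrefix
    (injOn_iterate_of_forall_ne fun m hm heq => hn (heq ▸ hmin m hm))
  refine ⟨orbitPrefix c.parent i n, fun a ha => ?_, c.parent^[n] i, hn, ?_, fun hempty => ?_,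
    ((Walk.of_lipschitz (D.dist_pos_le i) hw).append (c.parentNetwork.walk_iterate i n)).mono
      ((Set.subset_insert _ _).trans Set.subset_union_right) ?_⟩
  · obtain ⟨m, hm, rfl⟩ := mem_orbitPrefix.1 ha
    exact hmin m hm
  · cases n with
    | zero => exact hi
    | succ n =>
      rw [Function.iterate_succ_apply']
      exact h.parent_notMem _ (hmin n n.lt_succ_self)
  · rw [hempty, Finset.card_empty] at hcard
    rw [← hcard, Function.iterate_zero_apply]
  · rw [hcard]
    simp only [parentNetwork]
    linarith

theorem hasGrouping_of_earlier {w : ℝ} (hw : w < c.start i) (hw' : c.start j < w)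
    (hpos : D.pos i w = c.base j) : D.HasGrouping := by
  have hi : i ∉ c.idle r := fun hi => by
    linarith [c.start_nonneg j, h.start_eq_zero i hi]
  obtain ⟨N, hN, z, hzl, hzi, hNz, hlink⟩ := h.exists_walk_of_notMem_idle hi hw.le
  rw [hpos] at hlink
  by_cases hzr : Linked c.next z r
  · refine h.hasGrouping_of_link hj hleaf hN hzr ?_ hw' hlink
    refine N.eq_empty_or_nonempty.symm.imp_right fun hempty hzg => ?_
    rw [← hzg, hNz hempty] at hw'
    exact hw'.not_gt hw
  · exact h.hasGrouping_of_link_of_notMem hj hleaf hN hzl hzi hzr hw' hlink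

end Nontrivial

end IsRooted

end Config

section Update

variable {R : Type*} [DecidableEq R] {f : R → R} {r o i j z : R}

theorem Linked.of_update (h : Linked (Function.update f i j) z o)
    (ho' : Function.update f i j o = o) (ho : f o = o) (hr : f r = r) (hor : o ≠ r)
    (hj : Linked f j r) : Linked f z o := by
  obtain ⟨n, hn⟩ := h.exists_iterate_eq ho'
  clear h
  induction n generalizing z with
  | zero => exact ⟨0, 0, hn⟩
  | succ n ih =>
    have hz := ih hn
    obtain rfl | hzi := eq_or_ne z i
    · rw [Function.update_self] at hz
      exact absurd (hz.symm.trans hj) fun h => hor (h.eq_of_fixed ho hr)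
    · rw [Function.update_of_ne hzi] at hz
      exact (Linked.apply z).trans hz

theorem eq_of_update_eq {p : R → Prop} (hf : ∀ a b, f a = f b → p (f a) → a = b)
    (hj : ∀ z, f z ≠ j) (a b : R) (hab : Function.update f i j a = Function.update f i j b)
    (hp : p (Function.update f i j a)) : a = b := by
  by_cases ha : a = i <;> by_cases hb : b = i <;>
    simp only [ha, hb, Function.update_self, Function.update_of_ne, ne_eq, not_false_eq_true]
      at hab hp ⊢
  · exact absurd hab.symm (hj b)
  · exact absurd hab (hj a)
  · exact hf a b hab hp

end Update

namespace Config

variable {R P E : Type*} [MetricSpace E] [DecidableEq R] {D : PatrolRecord R P E} (c : Config D)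

/-! ### Moves -/

/-- Start the window of `j` later. -/
def raise (j : R) (t : ℝ) (hjt : c.start j ≤ t) (ht : t ≤ 1 / 2) (ht' : t ≤ c.finish j)
    (hcov : ∀ p, ∃ z s, (z, p, s) ∈ D.visits ∧
      s ∈ Set.Icc (Function.update c.start j t z) (c.finish z))
    (hj : j ∉ c.loops) (hleaf : ∀ z, c.next z ≠ j) : Config D where
  __ := c
  start := Function.update c.start j t
  start_nonneg z := (c.start_nonneg z).trans (le_update_self_iff.2 hjt z)
  start_le_half := (Function.forall_update_iff c.start fun _ s => s ≤ 1 / 2).2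
    ⟨ht, fun z _ => c.start_le_half z⟩
  start_le_finish := (Function.forall_update_iff c.start fun z s => s ≤ c.finish z).2
    ⟨ht', fun z _ => c.start_le_finish z⟩
  meet_le z := (c.meet_le z).trans (le_update_self_iff.2 hjt _)
  covers := hcov
  loop q hq := by
    rw [Function.update_of_ne (ne_of_mem_of_not_mem hq hj)]
    exact c.loop q hq
  eq_of_next_eq a b hab hpos := by
    rw [Function.update_of_ne (hleaf a)] at hpos
    exact c.eq_of_next_eq a b hab hpos

/-- Link `j` to itself. -/
def close (j : R) (hleaf : ∀ z, c.next z ≠ j)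
    (hloop : Walk (c.base j) (c.base j) (c.window j) 1) : Config D where
  __ := c
  loops := insert j c.loops
  loop q hq := (Finset.mem_insert.1 hq).elim (fun h => h ▸ hloop) (c.loop q)
  eq_of_next_mem_loops q hq z hz := by
    rw [Finset.piecewise_insert] at hz
    obtain rfl | hzj := eq_or_ne z j
    · rwa [Function.update_self] at hz
    · rw [Function.update_of_ne hzj] at hz
      obtain rfl | hq := Finset.mem_insert.1 hq
      · exact absurd hz (hleaf z)
      · exact c.eq_of_next_mem_loops q hq z hz
  eq_of_next_eq := by
    rw [Finset.piecewise_insert]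
    exact eq_of_update_eq (p := fun z => 0 < c.start z) c.eq_of_next_eq hleaf

theorem piecewise_erase_update (i j : R) :
    (c.loops.erase i).piecewise id (Function.update c.parent i j) = Function.update c.next i j := by
  ext z
  by_cases hz : z = i <;> simp [Finset.piecewise, hz]

/-- Extend the window of `i` to a visit of the base point of `j`, and link `i` to `j`. -/
def retarget (i j : R) (w : ℝ) (hleaf : ∀ z, c.next z ≠ j) (hj : j ∉ c.loops)
    (hw : c.finish i ≤ w) (hw' : w ≤ c.start j + 1) (hpos : D.pos i w = c.base j) :
    Config D where
  __ := c
  finish := Function.update c.finish i w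
  meet := Function.update c.meet i (c.start j)
  parent := Function.update c.parent i j
  loops := c.loops.erase i
  start_le_finish z := (c.start_le_finish z).trans (le_update_self_iff.2 hw z)
  meet_le z := by
    by_cases hz : z = i
    · simp [hz]
    · simpa [hz] using c.meet_le z
  finish_le z := by
    by_cases hz : z = i
    · simpa [hz] using hw'
    · simpa [hz] using c.finish_le z
  pos_meet z := by
    by_cases hz : z = i
    · simpa [hz, base] using hpos.symm
    · simpa [hz] using c.pos_meet z
  covers p := by
    obtain ⟨z, t, hv, hzt, htz⟩ := c.covers p
    exact ⟨z, t, hv, hzt, htz.trans (le_update_self_iff.2 hw z)⟩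
  loop q hq := by
    rw [Function.update_of_ne (Finset.ne_of_mem_erase hq)]
    exact c.loop q (Finset.mem_of_mem_erase hq)
  eq_of_next_mem_loops q hq z hz := by
    rw [piecewise_erase_update] at hz
    obtain rfl | hzi := eq_or_ne z i
    · rw [Function.update_self] at hz
      exact absurd (hz ▸ Finset.mem_of_mem_erase hq) hj
    · rw [Function.update_of_ne hzi] at hz
      exact c.eq_of_next_mem_loops q (Finset.mem_of_mem_erase hq) z hz
  eq_of_next_eq := by
    rw [piecewise_erase_update]
    exact eq_of_update_eq (p := fun z => 0 < c.start z) c.eq_of_next_eq hleaf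

variable [Fintype R]

namespace IsRooted

variable {c : Config D} {r : R} (h : c.IsRooted r)

include h

theorem notMem_loops {z : R} (hz : Linked c.next z r) : z ∉ c.loops := fun hzl =>
  h.root_notMem (hz.eq_of_fixed (c.next_of_mem hzl) h.next_root ▸ hzl)

theorem notMem_idle {z : R} (hz : Linked c.next z r) : z ∉ c.idle r := fun ⟨_, ho, hor, _, hzo⟩ =>
  hor ((hzo.symm.trans hz).eq_of_fixed ho h.next_root)

theorem of_update {c' : Config D} {i j : R} (hj : Linked c.next j r)
    (hnext : c'.next = Function.update c.next i j)
    (hfixed : ∀ o, c'.next o = o → o ∉ c'.loops → c.next o = o ∧ o ∉ c.loops)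
    (hparent : c'.parent r = r) (hstart : c'.start = c.start) (hr : r ∉ c'.loops)
    (hparent' : ∀ q ∈ c'.loops, c'.parent q ∉ c.idle r)
    (hexits : ∀ q, ∃ n, c'.parent^[n] q ∉ c'.loops) : c'.IsRooted r := by
  have hlinked : ∀ {z o}, c'.next o = o → o ≠ r → o ∉ c'.loops → Linked c'.next z o →
      Linked c.next z o := fun ho hor hol hzo =>
    (hnext ▸ hzo).of_update (hnext ▸ ho) (hfixed _ ho hol).1 h.next_root hor hj
  have hidle : c'.idle r ⊆ c.idle r := fun z ⟨o, ho, hor, hol, hzo⟩ =>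
    ⟨o, (hfixed o ho hol).1, hor, (hfixed o ho hol).2, hlinked ho hor hol hzo⟩
  refine ⟨hparent, hstart ▸ h.start_root, hr, fun z hz => ?_,
    fun z hz => hstart ▸ h.start_eq_zero z (hidle hz), fun q hq hmem => hparent' q hq (hidle hmem),
    hexits⟩
  have hsmall := h.small z (hidle hz)
  obtain ⟨o, ho, hor, hol, hzo⟩ := hz
  refine (Nat.mul_le_mul_left 2 (Finset.card_le_card fun a ha => ?_)).trans hsmall
  rw [mem_component] at ha ⊢
  exact (hlinked ho hor hol hzo).trans (hlinked ho hor hol (ha.symm.trans hzo)).symm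

theorem raise {j : R} {t : ℝ} {hjt ht ht' hcov hj hleaf} (hjr : Linked c.next j r) :
    (c.raise j t hjt ht ht' hcov hj hleaf).IsRooted r where
  __ := h
  start_root := by
    have hrj : r ≠ j := fun e => hleaf r (h.next_root.trans e)
    exact (Function.update_of_ne hrj _ _).trans h.start_root
  start_eq_zero z hz := by
    have hzj : z ≠ j := fun e => h.notMem_idle (e ▸ hjr) hz
    exact (Function.update_of_ne hzj _ _).trans (h.start_eq_zero z hz)

theorem close {j : R} {hleaf hloop} (hj : Linked c.next j r) :
    (c.close j hleaf hloop).IsRooted r := by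
  have hnext_parent := c.next_of_notMem (h.notMem_loops hj)
  have hjr : Linked c.next (c.parent j) r := hnext_parent ▸ (Linked.apply j).symm.trans hj
  refine h.of_update hj (Finset.piecewise_insert _ _ _ _) (fun o ho hol => ?_) h.parent_root rfl
    (fun hr => ?_) (fun q hq => ?_) fun q => ?_
  · obtain ⟨hoj, hol⟩ := not_or.1 (mt Finset.mem_insert.2 hol)
    have hnext : (c.close j hleaf hloop).next o = c.next o :=
      (congrFun (Finset.piecewise_insert _ _ _ _) o).trans (Function.update_of_ne hoj _ _)
    exact ⟨hnext.symm.trans ho, hol⟩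
  · rcases Finset.mem_insert.1 hr with rfl | hr
    · exact hleaf r h.next_root
    · exact h.root_notMem hr
  · rcases Finset.mem_insert.1 hq with rfl | hq
    · exact h.notMem_idle hjr
    · exact h.parent_notMem q hq
  · obtain ⟨n, hn⟩ := h.exits q
    by_cases hnj : c.parent^[n] q = j
    · refine ⟨n + 1, ?_⟩
      change c.parent^[n + 1] q ∉ insert j c.loops
      rw [Function.iterate_succ_apply', hnj, Finset.mem_insert, not_or]
      exact ⟨hnext_parent ▸ hleaf j, h.notMem_loops hjr⟩
    · exact ⟨n, mt Finset.mem_insert.1 (not_or.2 ⟨hnj, hn⟩)⟩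

theorem retarget {i j : R} {w : ℝ} {hleaf hj hw hw' hpos} (hjr : Linked c.next j r) (hij : i ≠ j)
    (hir : i ≠ r) : (c.retarget i j w hleaf hj hw hw' hpos).IsRooted r := by
  have hnext := c.piecewise_erase_update i j
  refine h.of_update hjr hnext (fun o ho hol => ?_)
    ((Function.update_of_ne hir.symm _ _).trans h.parent_root) rfl
    (fun hr => h.root_notMem (Finset.mem_of_mem_erase hr)) (fun q hq => ?_) fun q => ?_
  · have ho' := (congrFun hnext o).symm.trans ho
    obtain rfl | hoi := eq_or_ne o i
    · rw [Function.update_self] at ho'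
      exact absurd ho'.symm hij
    · rw [Function.update_of_ne hoi] at ho'
      exact ⟨ho', fun hl => hol (Finset.mem_erase.2 ⟨hoi, hl⟩)⟩
  · have hqi := Function.update_of_ne (Finset.ne_of_mem_erase hq) j c.parent
    exact fun hmem => h.parent_notMem q (Finset.mem_of_mem_erase hq) (hqi ▸ hmem)
  · obtain ⟨n, hn⟩ := h.exits q
    induction n generalizing q with
    | zero => exact ⟨0, mt Finset.mem_of_mem_erase hn⟩
    | succ n ih =>
      obtain rfl | hqi := eq_or_ne q i
      · exact ⟨0, Finset.notMem_erase q _⟩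
      · obtain ⟨m, hm⟩ := ih _ hn
        refine ⟨m + 1, ?_⟩
        change (Function.update c.parent i j)^[m + 1] q ∉ _
        rw [Function.iterate_succ_apply, Function.update_of_ne hqi]
        exact hm

end IsRooted

end Config

namespace Config

variable {R P E : Type*} [MetricSpace E] [DecidableEq R] {D : PatrolRecord R P E} (c : Config D)

theorem exists_visit_of_not_covers {j : R} {t : ℝ} (hj : c.start j ≤ 1 / 2)
    (ht : ∀ {z p s}, (z, p, s) ∈ D.visits → c.start j < s → t ≤ s)
    (hcov : ¬ ∀ p, ∃ z s, (z, p, s) ∈ D.visits ∧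
      s ∈ Set.Icc (Function.update c.start j t z) (c.finish z)) :
    ∃ i p w, (i, p, w) ∈ D.visits ∧ D.pos i w = c.base j ∧ c.start j < w ∧ w ≤ c.start j + 1 ∧
      (w < c.start i ∨ c.finish i < w) := by
  push Not at hcov
  obtain ⟨p, hp⟩ := hcov
  have honly : ∀ z s, (z, p, s) ∈ D.visits → s ∈ Set.Icc (c.start z) (c.finish z) →
      z = j ∧ s = c.start j := fun z s hv hs => by
    have hzs := hp z s hv
    obtain rfl : z = j := by_contra fun hzj => hzs (by rwa [Function.update_of_ne hzj])
    rw [Function.update_self] at hzs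
    refine ⟨rfl, hs.1.antisymm' (not_lt.1 fun hlt => hzs ⟨ht hv hlt, hs.2⟩)⟩
  have hbase : c.base j = D.point p := by
    obtain ⟨z, s, hv, hs⟩ := c.covers p
    obtain ⟨rfl, rfl⟩ := honly z s hv hs
    exact D.pos_eq hv
  obtain ⟨i, w, hv, hjw, hwj⟩ := D.forward p (c.start j) (c.start_nonneg j) hj
  refine ⟨i, p, w, hv, (D.pos_eq hv).trans hbase.symm, hjw, hwj, ?_⟩
  by_contra! hw
  exact hjw.ne' (honly i w hv hw).2

variable [Fintype R]

/-! ### Progress -/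

/-- How many of the times in `Θ` the windows have passed, and then how many loops there are: a
measure that each of the moves increases. -/
noncomputable def progress (Θ : Finset ℝ) : ℕ :=
  (∑ z, (#{θ ∈ Θ | θ ≤ c.start z} + #{θ ∈ Θ | θ ≤ c.finish z})) * (Fintype.card R + 1) + #c.loops

theorem progress_le (Θ : Finset ℝ) :
    c.progress Θ ≤ Fintype.card R * (2 * #Θ) * (Fintype.card R + 1) + Fintype.card R := by
  have hsum := Finset.sum_le_card_nsmul Finset.univ
    (fun z => #{θ ∈ Θ | θ ≤ c.start z} + #{θ ∈ Θ | θ ≤ c.finish z}) (2 * #Θ) fun z _ => by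
      rw [two_mul]
      exact add_le_add (Finset.card_filter_le _ _) (Finset.card_filter_le _ _)
  exact add_le_add (Nat.mul_le_mul_right _ hsum) c.loops.card_le_univ

omit [DecidableEq R] [Fintype R] in
theorem card_filter_le_mono (Θ : Finset ℝ) : Monotone fun x => #{θ ∈ Θ | θ ≤ x} := fun _ _ hxy =>
  Finset.card_le_card (Finset.monotone_filter_right _ fun _ _ h => h.trans hxy)

theorem card_filter_le_lt {Θ : Finset ℝ} {x y θ : ℝ} (hθ : θ ∈ Θ) (hx : x < θ) (hy : θ ≤ y) :
    #{θ ∈ Θ | θ ≤ x} < #{θ ∈ Θ | θ ≤ y} := by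
  refine Finset.card_lt_card ((Finset.ssubset_iff_of_subset (Finset.monotone_filter_right _
    fun _ _ h => h.trans (hx.le.trans hy))).2 ⟨θ, ?_, ?_⟩)
  · simp [hθ, hy]
  · simp [hx]

theorem progress_lt {Θ : Finset ℝ} {c c' : Config D} (hstart : c.start ≤ c'.start)
    (hfinish : c.finish ≤ c'.finish) {z : R} {θ : ℝ} (hθ : θ ∈ Θ)
    (hz : c.start z < θ ∧ θ ≤ c'.start z ∨ c.finish z < θ ∧ θ ≤ c'.finish z) :
    c.progress Θ < c'.progress Θ := by
  have hsum : ∑ z, (#{θ ∈ Θ | θ ≤ c.start z} + #{θ ∈ Θ | θ ≤ c.finish z}) <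
      ∑ z, (#{θ ∈ Θ | θ ≤ c'.start z} + #{θ ∈ Θ | θ ≤ c'.finish z}) := by
    refine Finset.sum_lt_sum (fun z _ => add_le_add (card_filter_le_mono Θ (hstart z))
      (card_filter_le_mono Θ (hfinish z))) ⟨z, Finset.mem_univ _, ?_⟩
    rcases hz with ⟨hlt, hle⟩ | ⟨hlt, hle⟩
    · exact add_lt_add_of_lt_of_le (card_filter_le_lt hθ hlt hle)
        (card_filter_le_mono Θ (hfinish z))
    · exact add_lt_add_of_le_of_lt (card_filter_le_mono Θ (hstart z))
        (card_filter_le_lt hθ hlt hle)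
  have hloops := c.loops.card_le_univ
  unfold progress
  nlinarith

namespace IsRooted

variable {c : Config D} {r j : R} (h : c.IsRooted r) {Θ : Finset ℝ}

include h

theorem exists_leaf (hcard : 1 < #(component c.next r)) :
    ∃ j, Linked c.next j r ∧ ∀ z, c.next z ≠ j := by
  by_contra! hno
  have hsurj : Set.SurjOn c.next (component c.next r) (component c.next r) := fun j hj => by
    obtain ⟨z, hz⟩ := hno j (mem_component.1 hj).symm
    exact ⟨z, apply_mem_component.1 (hz ▸ hj), hz⟩
  have hmaps : Set.MapsTo c.next (component c.next r) (component c.next r) := fun z hz =>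
    apply_mem_component.2 hz
  have hinj := Finset.injOn_of_surjOn_of_card_le c.next hmaps hsurj le_rfl
  obtain ⟨z, hz, hzr⟩ := Finset.exists_mem_ne hcard r
  obtain ⟨n, hn⟩ := (mem_component.1 hz).symm.exists_iterate_eq h.next_root
  exact hzr (hinj.iterate hmaps n hz (self_mem_component r)
    (hn.trans (Function.iterate_fixed h.next_root n).symm))

variable (hj : Linked c.next j r) (hleaf : ∀ z, c.next z ≠ j)

include hj hleaf

theorem exists_progress_of_walk (hloop : Walk (c.base j) (c.base j) (c.window j) 1) :
    ∃ c' : Config D, c'.IsRooted r ∧ c.progress Θ < c'.progress Θ := by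
  refine ⟨c.close j hleaf hloop, h.close hj, add_lt_add_right ?_ _⟩
  exact Finset.card_lt_card (Finset.ssubset_insert (h.notMem_loops hj))

theorem exists_progress_of_finish_lt (hfinish : c.finish j < c.start j + 1 / 2) :
    ∃ c' : Config D, c'.IsRooted r ∧ c.progress Θ < c'.progress Θ := by
  have hwalk := (Walk.of_lipschitz (D.dist_pos_le j) (c.start_le_finish j)).double
  exact h.exists_progress_of_walk hj hleaf
    (hwalk.mono (fun _ hs => .inr (.inr hs)) (by linarith))

theorem exists_progress_of_covers {t : ℝ} (hjt : c.start j < t) (ht : t ≤ 1 / 2)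
    (htΘ : t ∈ Θ) (ht' : t ≤ c.finish j)
    (hcov : ∀ p, ∃ z s, (z, p, s) ∈ D.visits ∧
      s ∈ Set.Icc (Function.update c.start j t z) (c.finish z)) :
    ∃ c' : Config D, c'.IsRooted r ∧ c.progress Θ < c'.progress Θ := by
  have hjl := h.notMem_loops hj
  exact ⟨c.raise j t hjt.le ht ht' hcov hjl hleaf, h.raise hj,
    progress_lt (le_update_self_iff.2 hjt.le) le_rfl htΘ
      (.inl ⟨hjt, (Function.update_self j t c.start).ge⟩)⟩

theorem exists_progress_of_link {i : R} {w : ℝ} (hij : i ≠ j) (hir : i ≠ r) (hwΘ : w ∈ Θ)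
    (hw : c.finish i < w) (hw' : w ≤ c.start j + 1) (hpos : D.pos i w = c.base j) :
    ∃ c' : Config D, c'.IsRooted r ∧ c.progress Θ < c'.progress Θ :=
  ⟨c.retarget i j w hleaf (h.notMem_loops hj) hw.le hw' hpos, h.retarget hj hij hir,
    progress_lt le_rfl (le_update_self_iff.2 hw.le) hwΘ
      (.inr ⟨hw, (Function.update_self i w c.finish).ge⟩)⟩

variable [Nontrivial R]

theorem hasGrouping_or_exists_progress_of_visit {i : R} {w : ℝ} (hwΘ : w ∈ Θ)
    (hpos : D.pos i w = c.base j) (hjw : c.start j < w) (hwj : w ≤ c.start j + 1)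
    (hw : w < c.start i ∨ c.finish i < w) :
    D.HasGrouping ∨ ∃ c' : Config D, c'.IsRooted r ∧ c.progress Θ < c'.progress Θ := by
  obtain hw | hw := hw
  · exact .inl (h.hasGrouping_of_earlier hj hleaf hw hjw hpos)
  obtain rfl | hij := eq_or_ne i j
  · exact .inr (h.exists_progress_of_walk hj hleaf
      ((c.walk_of_later hw hpos).mono subset_rfl (by linarith)))
  obtain rfl | hir := eq_or_ne i r
  · exact .inl (h.hasGrouping_of_root_later hj hleaf hw hwj hpos)
  exact .inr (h.exists_progress_of_link hj hleaf hij hir hwΘ hw hwj hpos)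

omit hj hleaf

theorem hasGrouping_or_exists_progress (hΘ : ∀ {z p t}, (z, p, t) ∈ D.visits → t ∈ Θ)
    (hhalf : 1 / 2 ∈ Θ) :
    D.HasGrouping ∨ ∃ c' : Config D, c'.IsRooted r ∧ c.progress Θ < c'.progress Θ := by
  obtain hsmall | hlarge := le_or_gt (2 * #(component c.next r)) (Fintype.card R)
  · exact .inl (h.hasGrouping_of_small hsmall)
  have hR := Fintype.one_lt_card (α := R)
  obtain ⟨j, hj, hleaf⟩ := h.exists_leaf (by omega)
  obtain hjhalf | hjhalf := le_or_gt (1 / 2) (c.start j)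
  · exact .inl (h.hasGrouping_of_half_le hj hleaf hjhalf)
  obtain ⟨t, ⟨htΘ, hjt⟩, htmin⟩ := Set.exists_min_image {t | t ∈ Θ ∧ c.start j < t} id
    (Θ.finite_toSet.subset fun _ => And.left) ⟨1 / 2, hhalf, hjhalf⟩
  have ht : t ≤ 1 / 2 := htmin _ ⟨hhalf, hjhalf⟩
  obtain hfinish | hfinish := lt_or_ge (c.finish j) t
  · exact .inr (h.exists_progress_of_finish_lt hj hleaf (by linarith [c.start_nonneg j]))
  by_cases hcov : ∀ p, ∃ z s, (z, p, s) ∈ D.visits ∧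
      s ∈ Set.Icc (Function.update c.start j t z) (c.finish z)
  · exact .inr (h.exists_progress_of_covers hj hleaf hjt ht htΘ hfinish hcov)
  obtain ⟨i, p, w, hv, hpos, hjw, hwj, hw⟩ := c.exists_visit_of_not_covers hjhalf.le
    (fun hv hjs => htmin _ ⟨hΘ hv, hjs⟩) hcov
  exact h.hasGrouping_or_exists_progress_of_visit hj hleaf (hΘ hv) hpos hjw hwj hw

theorem hasGrouping : D.HasGrouping := by
  classical
  let Θ : Finset ℝ := insert (1 / 2) (D.finite_visits.toFinset.image fun v => v.2.2)
  have hΘ : ∀ {z p t}, (z, p, t) ∈ D.visits → t ∈ Θ := fun {z p t} hv =>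
    Finset.mem_insert_of_mem (Finset.mem_image.2 ⟨(z, p, t), by simpa using hv, rfl⟩)
  induction hn : Fintype.card R * (2 * #Θ) * (Fintype.card R + 1) + Fintype.card R -
    c.progress Θ using Nat.strong_induction_on generalizing c with
  | _ n ih =>
    obtain hg | ⟨c', hc', hlt⟩ := h.hasGrouping_or_exists_progress hΘ (Finset.mem_insert_self _ _)
    · exact hg
    · have hle := c'.progress_le Θ
      exact ih _ (by omega) hc' rfl

end IsRooted

end Config

namespace PatrolRecord

variable {R P E : Type*} [MetricSpace E] (D : PatrolRecord R P E)

theorem exists_first_visit (p : P) :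
    ∃ z v, (z, p, v) ∈ D.visits ∧ 0 ≤ v ∧ ∃ i, ∃ w ≤ 0, v ≤ w + 1 ∧ D.pos i w = D.pos z v := by
  obtain ⟨z, s, hs, hs0, hs1⟩ := D.forward p 0 le_rfl (by norm_num)
  obtain ⟨⟨z, q, v⟩, ⟨hv, rfl, hv0⟩, hmin⟩ := Set.exists_min_image
    (D.visits ∩ {x | x.2.1 = p ∧ 0 ≤ x.2.2}) (fun x => x.2.2) (D.finite_visits.inter_of_left _)
    ⟨(z, p, s), hs, rfl, hs0.le⟩
  refine ⟨z, v, hv, hv0, ?_⟩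
  obtain hv_eq | hv_pos := hv0.eq_or_lt
  · exact ⟨z, v, hv_eq.ge, by linarith, rfl⟩
  have hv1 : v ≤ s := hmin (_, q, s) ⟨hs, rfl, hs0.le⟩
  obtain ⟨i, w, hw, hvw, hwv⟩ := D.backward q v hv_pos (by linarith)
  exact ⟨i, w, not_lt.1 fun hw0 => hwv.not_ge (hmin (i, q, w) ⟨hw, rfl, hw0.le⟩), by linarith,
    (D.pos_eq hw).trans (D.pos_eq hv).symm⟩

/-- The windows extend up to the first visits. -/
theorem exists_config [Finite P] [DecidableEq R] :
    ∃ c : Config D, (∀ z, c.start z = 0) ∧ c.loops = ∅ := by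
  choose robotOf first hvisit hfirst earlier time htime hfirst_le hpos using D.exists_first_visit
  have hwindow : ∀ z, ∃ finish parent meet, 0 ≤ finish ∧ meet ≤ 0 ∧ finish ≤ meet + 1 ∧
      D.pos parent meet = D.pos z finish ∧ ∀ p, robotOf p = z → first p ≤ finish := fun z => by
    obtain hempty | hne := {p | robotOf p = z}.eq_empty_or_nonempty
    · exact ⟨0, z, 0, le_rfl, le_rfl, by norm_num, rfl, fun p hp =>
        absurd hp (Set.eq_empty_iff_forall_notMem.1 hempty p)⟩
    · obtain ⟨p, rfl, hmax⟩ := Set.exists_max_image _ first (Set.toFinite _) hne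
      exact ⟨first p, earlier p, time p, hfirst p, htime p, hfirst_le p, hpos p, hmax⟩
  choose finish parent meet hfinish hmeet hfinish_le hpos_meet hmax using hwindow
  exact ⟨{
    start := 0
    finish := finish
    meet := meet
    parent := parent
    loops := ∅
    start_nonneg := fun _ => le_rfl
    start_le_half := fun _ => by norm_num
    start_le_finish := hfinish
    meet_le := hmeet
    finish_le := hfinish_le
    pos_meet := hpos_meet
    covers := fun p => ⟨robotOf p, first p, hvisit p, hfirst p, hmax _ p rfl⟩
    loop := by simp
    eq_of_next_mem_loops := by simp
    eq_of_next_eq := fun _ _ _ h => absurd h (lt_irrefl 0) }, fun _ => rfl, rfl⟩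

theorem hasGrouping [Finite P] [Fintype R] [Nontrivial R] : D.HasGrouping := by
  classical
  obtain ⟨c, hstart, hloops⟩ := D.exists_config
  have hnot : ∀ z, z ∉ c.loops := by simp [hloops]
  by_cases hlarge : ∃ r, c.next r = r ∧ Fintype.card R < 2 * #(component c.next r)
  · obtain ⟨r, hr, hcard⟩ := hlarge
    refine Config.IsRooted.hasGrouping (c := c) (r := r)
      ⟨(c.next_of_notMem (hnot r)).symm.trans hr, hstart r, hnot r, ?_, fun z _ => hstart z,
        fun q hq => absurd hq (hnot q), fun _ => ⟨0, hnot _⟩⟩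
    rintro z ⟨o, ho, hor, -, hzo⟩
    have hdisj : Disjoint (component c.next z) (component c.next r) :=
      Finset.disjoint_left.2 fun a haz har => hor <|
        Linked.eq_of_fixed ho hr <|
          (hzo.symm.trans (mem_component.1 haz)).trans (mem_component.1 har).symm
    have hle := Finset.card_le_univ (component c.next z ∪ component c.next r)
    rw [Finset.card_union_of_disjoint hdisj] at hle
    omega
  · push Not at hlarge
    exact c.hasGrouping ∅ (by simp) (by simp) fun o ho _ _ => hlarge o ho

end PatrolRecord

/-! ### The record of a schedule -/

theorem exists_mem_Ioc_of_mem_Ioo {A B s t : ℝ} (hs : s ∈ Set.Icc A B)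
    (hst : s ∈ Set.Ioo t (t + 1)) :
    ∃ w ∈ Set.Icc A B, w ∈ Set.Ioc t (t + 1) ∧ (w = A ∨ w = B ∨ ∃ i : ℤ, w = i) := by
  have hAB : A ≤ B := hs.1.trans hs.2
  by_cases hA : t < A
  · exact ⟨A, ⟨le_rfl, hAB⟩, ⟨hA, hs.1.trans hst.2.le⟩, .inl rfl⟩
  by_cases hB : B ≤ t + 1
  · exact ⟨B, ⟨hAB, le_rfl⟩, ⟨hst.1.trans_le hs.2, hB⟩, .inr (.inl rfl)⟩
  have hlt := Int.lt_floor_add_one t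
  have hle := Int.floor_le t
  exact ⟨⌊t⌋ + 1, ⟨by linarith, by linarith⟩, ⟨hlt, by linarith⟩,
    .inr (.inr ⟨⌊t⌋ + 1, by push_cast; rfl⟩)⟩

theorem exists_mem_Ico_of_mem_Ioo {A B s t : ℝ} (hs : s ∈ Set.Icc A B)
    (hst : s ∈ Set.Ioo t (t + 1)) :
    ∃ w ∈ Set.Icc A B, w ∈ Set.Ico t (t + 1) ∧ (w = A ∨ w = B ∨ ∃ i : ℤ, w = i) := by
  obtain ⟨w, hw, hwt, hcases⟩ := exists_mem_Ioc_of_mem_Ioo (t := -(t + 1))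
    (Set.neg_mem_Icc_iff.2 (by simpa using hs) : -s ∈ Set.Icc (-B) (-A))
    ⟨neg_lt_neg hst.2, by linarith [hst.1]⟩
  refine ⟨-w, ⟨le_neg.1 hw.2, neg_le.1 hw.1⟩, ⟨by linarith [hwt.2], by linarith [hwt.1]⟩, ?_⟩
  obtain rfl | rfl | ⟨i, rfl⟩ := hcases
  · exact .inr (.inl (neg_neg B))
  · exact .inl (neg_neg A)
  · exact .inr (.inr ⟨-i, by push_cast; rfl⟩)

namespace RobotSchedule

variable {P : Type*} [MetricSpace P] (f : RobotSchedule P)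

theorem dist_site_le {n m : ℕ} (h : n < m) :
    dist (f.site n) (f.site m) ≤ f.arrive m - f.depart n := by
  induction m, h using Nat.le_induction with
  | base => exact f.speed_limit n
  | succ m _ ih =>
    linarith [dist_triangle (f.site n) (f.site m) (f.site (m + 1)), f.speed_limit m,
      f.arrive_le_depart m]

theorem dist_site_le_abs {n m : ℕ} {s t : ℝ} (hs : s ∈ Set.Icc (f.arrive n) (f.depart n))
    (ht : t ∈ Set.Icc (f.arrive m) (f.depart m)) : dist (f.site n) (f.site m) ≤ |s - t| := by
  rcases lt_trichotomy n m with h | rfl | h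
  · linarith [f.dist_site_le h, hs.2, ht.1, neg_abs_le (s - t)]
  · simp
  · rw [dist_comm]
    linarith [f.dist_site_le h, hs.1, ht.2, le_abs_self (s - t)]

theorem exists_path [TopologicalSpace.SeparableSpace P] :
    ∃ x : ℝ → ℓ^∞(ℕ, ℝ), LipschitzWith 1 x ∧
      ∀ n, ∀ t ∈ Set.Icc (f.arrive n) (f.depart n), x t = kuratowskiEmbedding P (f.site n) := by
  classical
  let S := {t | ∃ n, t ∈ Set.Icc (f.arrive n) (f.depart n)}
  choose! stage hstage using fun (t : ℝ) (ht : t ∈ S) => ht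
  have hlip : LipschitzOnWith 1 (fun t => kuratowskiEmbedding P (f.site (stage t))) S :=
    LipschitzOnWith.of_dist_le_mul fun s hs t ht => by
      rw [NNReal.coe_one, one_mul, (kuratowskiEmbedding.isometry P).dist_eq]
      exact f.dist_site_le_abs (hstage s hs) (hstage t ht)
  obtain ⟨x, hx, heq⟩ := hlip.extend_lp_infty
  refine ⟨x, hx, fun n t ht => (heq ⟨n, ht⟩).symm.trans (congrArg _ ?_)⟩
  simpa using f.dist_site_le_abs (hstage t ⟨n, ht⟩) ht

theorem finite_arrive_le (T : ℝ) : {n | f.arrive n ≤ T}.Finite := by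
  have h := f.tendsto_arrive.eventually_gt_atTop T
  rw [← Nat.cofinite_eq_atTop, Filter.eventually_cofinite] at h
  simpa using h

/-- The time interval of the `n`-th stay in units of `L`. The shift by `-2` makes room for
visits shortly before the new time `0`. -/
def stay (L : ℝ) (n : ℕ) : Set ℝ := Set.Icc (f.arrive n / L - 2) (f.depart n / L - 2)

theorem mem_stay {L : ℝ} (hL : 0 < L) {n : ℕ} {t : ℝ} :
    t ∈ f.stay L n ↔ L * (t + 2) ∈ Set.Icc (f.arrive n) (f.depart n) := by
  simp only [stay, Set.mem_Icc, sub_le_iff_le_add, le_sub_iff_add_le, div_le_iff₀' hL,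
    le_div_iff₀' hL]

end RobotSchedule

namespace Schedule

variable {P : Type*} [MetricSpace P] {k : ℕ} (σ : Schedule P k) {L : ℝ}

theorem exists_visitsAt (hL : 0 < L) (h : σ.latency < ENNReal.ofReal L) (p : P) {a : ℝ}
    (ha : 0 ≤ a) : ∃ t, a < t ∧ t < a + L ∧ ∃ r, (σ r).VisitsAt p t := by
  by_contra! hno
  refine absurd h (not_lt.2 ?_)
  calc ENNReal.ofReal L = ENNReal.ofReal (a + L - a) := by rw [add_sub_cancel_left]
    _ ≤ σ.siteLatency p :=
      le_iSup_of_le a <| le_iSup_of_le (a + L) <| le_iSup_of_le ha <|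
        le_iSup_of_le (by linarith) <| le_iSup_of_le hno le_rfl
    _ ≤ σ.latency := le_iSup σ.siteLatency p

theorem exists_mem_stay (hL : 0 < L) (h : σ.latency < ENNReal.ofReal L) (p : P) {t : ℝ}
    (ht : -2 ≤ t) : ∃ z n, (σ z).site n = p ∧ ∃ s ∈ (σ z).stay L n, s ∈ Set.Ioo t (t + 1) := by
  obtain ⟨s, hts, hst, z, n, hp, hs⟩ := σ.exists_visitsAt hL h p
    (a := L * (t + 2)) (mul_nonneg hL.le (by linarith))
  refine ⟨z, n, hp, s / L - 2, ((σ z).mem_stay hL).2 ?_, ?_, ?_⟩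
  · rwa [sub_add_cancel, mul_div_cancel₀ _ hL.ne']
  · rw [lt_sub_iff_add_lt, lt_div_iff₀' hL]
    exact hts
  · rw [sub_lt_iff_lt_add, div_lt_iff₀' hL]
    linarith

/-- The visits at the start, at the end, or at an integer time of a stay, in units of `L`. -/
def timedVisits (L : ℝ) : Set (Fin k × P × ℝ) :=
  {(z, p, t) : Fin k × P × ℝ | t ∈ Set.Icc (-1) 2 ∧ ∃ n, (σ z).site n = p ∧ t ∈ (σ z).stay L n ∧
    (t = (σ z).arrive n / L - 2 ∨ t = (σ z).depart n / L - 2 ∨ ∃ i : ℤ, t = i)}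

theorem finite_timedVisits [Finite P] (hL : 0 < L) : (σ.timedVisits L).Finite := by
  have hints : ((fun i : ℤ => (i : ℝ)) '' Set.Icc (-1) 2).Finite := (Set.finite_Icc _ _).image _
  have hends : (⋃ z, ⋃ n ∈ {n | (σ z).arrive n ≤ L * 4},
      {(σ z).arrive n / L - 2, (σ z).depart n / L - 2}).Finite :=
    Set.finite_iUnion fun z => ((σ z).finite_arrive_le _).biUnion fun n _ => Set.toFinite _
  refine (Set.finite_univ.prod (Set.finite_univ.prod (hints.union hends))).subset ?_
  rintro ⟨z, p, t⟩ ⟨ht, n, -, hstay, hcases⟩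
  refine ⟨trivial, trivial, ?_⟩
  have hn : (σ z).arrive n ≤ L * 4 := (((σ z).mem_stay hL).1 hstay).1.trans
    (mul_le_mul_of_nonneg_left (by linarith [ht.2]) hL.le)
  obtain heq | heq | ⟨i, rfl⟩ := hcases
  · exact .inr (Set.mem_iUnion.2 ⟨z, Set.mem_biUnion hn (.inl heq)⟩)
  · exact .inr (Set.mem_iUnion.2 ⟨z, Set.mem_biUnion hn (.inr heq)⟩)
  · exact .inl ⟨i, ⟨by exact_mod_cast ht.1, by exact_mod_cast ht.2⟩, rfl⟩

theorem exists_patrolRecord [Finite P] (hL : 0 < L) (h : σ.latency < ENNReal.ofReal L) :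
    ∃ D : PatrolRecord (Fin k) P ℓ^∞(ℕ, ℝ),
      ∀ p q, dist (D.point p) (D.point q) = L⁻¹ * dist p q := by
  choose x hx hxsite using fun z => (σ z).exists_path
  have hdist : ∀ u v : ℓ^∞(ℕ, ℝ), dist (L⁻¹ • u) (L⁻¹ • v) = L⁻¹ * dist u v := fun u v => by
    rw [dist_smul₀, Real.norm_of_nonneg (inv_nonneg.2 hL.le)]
  refine ⟨{
    pos := fun z t => L⁻¹ • x z (L * (t + 2))
    dist_pos_le := fun z s t => ?_
    point := fun p => L⁻¹ • kuratowskiEmbedding P p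
    visits := σ.timedVisits L
    finite_visits := σ.finite_timedVisits hL
    pos_eq := ?_
    forward := fun p t ht ht' => ?_
    backward := fun p t ht ht' => ?_ },
    fun p q => by rw [hdist, (kuratowskiEmbedding.isometry P).dist_eq]⟩
  · rw [hdist, inv_mul_le_iff₀ hL]
    refine ((hx z).dist_le_mul _ _).trans_eq ?_
    rw [NNReal.coe_one, one_mul, Real.dist_eq, ← mul_sub, add_sub_add_right_eq_sub, abs_mul,
      abs_of_pos hL]
  · rintro z p t ⟨-, n, rfl, hstay, -⟩
    exact congrArg _ (hxsite z n _ (((σ z).mem_stay hL).1 hstay))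
  · obtain ⟨z, n, hp, s, hs, hst⟩ := σ.exists_mem_stay hL h p (t := t) (by linarith)
    obtain ⟨w, hw, hwt, hcases⟩ := exists_mem_Ioc_of_mem_Ioo hs hst
    exact ⟨z, w, ⟨⟨by linarith [hwt.1], by linarith [hwt.2]⟩, n, hp, hw, hcases⟩, hwt⟩
  · obtain ⟨z, n, hp, s, hs, hst⟩ := σ.exists_mem_stay hL h p (t := t - 1) (by linarith)
    obtain ⟨w, hw, hwt, hcases⟩ := exists_mem_Ico_of_mem_Ioo hs hst
    rw [sub_add_cancel] at hwt
    exact ⟨z, w, ⟨⟨by linarith [hwt.1], by linarith [hwt.2]⟩, n, hp, hw, hcases⟩, hwt⟩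

end Schedule

/-! ### Tours -/

section Tour

variable {P : Type*} {S : Set P} {m : ℕ} {c : Fin (m + 1) → P}

theorem IsTour.eq_natCard (h : IsTour S c) : m + 1 = Nat.card S := by
  rw [← h.2, Nat.card_range_of_injective h.1, Nat.card_eq_fintype_card, Fintype.card_fin]

theorem IsTour.nonempty (h : IsTour S c) : S.Nonempty := h.2 ▸ Set.range_nonempty c

theorem exists_isTour_strictMono {α : Type*} [LinearOrder α] (hS : S.Finite) (hne : S.Nonempty)
    {τ : P → α} (hτ : S.InjOn τ) :
    ∃ (m : ℕ) (c : Fin (m + 1) → P), IsTour S c ∧ StrictMono (τ ∘ c) := by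
  classical
  have himage : (hS.toFinset.image τ).Nonempty := (hS.toFinset_nonempty.2 hne).image τ
  obtain ⟨m, hm⟩ := Nat.exists_eq_succ_of_ne_zero himage.card_pos.ne'
  let e := (hS.toFinset.image τ).orderEmbOfFin hm
  have hrange : Set.range e = τ '' S := by
    simp [e]
  choose c hcS hc using fun i => hrange.subset (Set.mem_range_self i)
  have hcomp : τ ∘ c = e := funext hc
  refine ⟨m, c, ⟨.of_comp (f := τ) (hcomp ▸ e.injective), ?_⟩, hcomp ▸ e.strictMono⟩
  refine (Set.range_subset_iff.2 hcS).antisymm fun p hp => ?_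
  obtain ⟨i, hi⟩ := hrange.superset (Set.mem_image_of_mem τ hp)
  exact ⟨i, hτ (hcS i) hp ((hc i).trans hi)⟩

variable [MetricSpace P]

theorem exists_isTSPTour (hS : S.Finite) (hne : S.Nonempty) :
    ∃ (m : ℕ) (c : Fin (m + 1) → P), IsTSPTour S c := by
  have := hS.to_subtype
  have := hne.to_subtype
  obtain ⟨m, hm⟩ := Nat.exists_eq_succ_of_ne_zero (Nat.card_pos (α := S)).ne'
  let e := (Finite.equivFinOfCardEq hm).symm
  have htour : IsTour S fun i => (e i : P) :=
    ⟨Subtype.val_injective.comp e.injective,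
      (e.surjective.range_comp Subtype.val).trans Subtype.range_coe⟩
  have hfin : {c : Fin (m + 1) → P | IsTour S c}.Finite :=
    (Set.Finite.pi' fun _ => hS).subset fun c hc i => hc.2.subset (Set.mem_range_self i)
  obtain ⟨c, hc, hmin⟩ := Set.exists_min_image _ tourLength hfin ⟨_, htour⟩
  exact ⟨m, c, hc, hmin⟩

theorem IsTSPTour.tourLength_le (hc : IsTSPTour S c) {m' : ℕ} {c' : Fin (m' + 1) → P}
    (hc' : IsTour S c') : tourLength c ≤ tourLength c' := by
  obtain rfl : m' = m := Nat.succ_injective (hc'.eq_natCard.trans hc.1.eq_natCard.symm)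
  exact hc.2 c' hc'

theorem tourLength_eq (c : Fin (m + 1) → P) :
    tourLength c = ∑ i : Fin m, dist (c i.castSucc) (c i.succ) + dist (c (Fin.last m)) (c 0) := by
  rw [tourLength, Fin.sum_univ_castSucc, Fin.last_add_one]
  simp only [Fin.coeSucc_eq_succ]

theorem tourLength_le_of_monotone {τ : Fin (m + 1) → ℝ} {ℓ : ℝ} (hτ : Monotone τ)
    (hstep : ∀ i j, dist (c i) (c j) ≤ |τ i - τ j|)
    (hwrap : dist (c (Fin.last m)) (c 0) ≤ ℓ - (τ (Fin.last m) - τ 0)) : tourLength c ≤ ℓ := by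
  have htelescope : ∑ i : Fin m, (τ i.succ - τ i.castSucc) = τ (Fin.last m) - τ 0 := by
    rw [Finset.sum_sub_distrib]
    linarith [Fin.sum_univ_succ τ, Fin.sum_univ_castSucc τ]
  have hsum : ∑ i : Fin m, dist (c i.castSucc) (c i.succ) ≤ τ (Fin.last m) - τ 0 := by
    rw [← htelescope]
    refine Finset.sum_le_sum fun i _ => (hstep _ _).trans_eq ?_
    rw [abs_sub_comm, abs_of_nonneg (sub_nonneg.2 (hτ i.castSucc_lt_succ.le))]
  rw [tourLength_eq]
  linarith

/-- Shortcutting the walk gives the tour. -/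
theorem Walk.exists_isTour {E : Type*} [MetricSpace E] (hS : S.Finite) (hne : S.Nonempty)
    {f : P → E} {L : ℝ} (hL : 0 ≤ L) (hf : ∀ p q, dist p q ≤ L * dist (f p) (f q)) {y : E} {ℓ : ℝ}
    (hw : Walk y y (f '' S) ℓ) :
    ∃ (m : ℕ) (c : Fin (m + 1) → P), IsTour S c ∧ tourLength c ≤ L * ℓ := by
  obtain ⟨-, t, hends, hdist⟩ := hw
  rw [Set.forall_mem_image] at hends
  simp only [Set.forall_mem_image] at hdist
  let τ : P → ℝ := fun p => L * t (f p)
  have hτ : ∀ p ∈ S, ∀ q ∈ S, dist p q ≤ |τ p - τ q| := fun p hp q hq => by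
    rw [← mul_sub, abs_mul, abs_of_nonneg hL]
    exact (hf p q).trans (mul_le_mul_of_nonneg_left (hdist hp hq) hL)
  have hwrap : ∀ p ∈ S, ∀ q ∈ S, dist p q ≤ L * ℓ - (τ p - τ q) := fun p hp q hq => by
    have hle : dist (f p) (f q) ≤ ℓ - (t (f p) - t (f q)) := by
      linarith [dist_triangle (f p) y (f q), (hends hp).2, (hends hq).1]
    calc dist p q ≤ L * dist (f p) (f q) := hf p q
      _ ≤ L * (ℓ - (t (f p) - t (f q))) := mul_le_mul_of_nonneg_left hle hL
      _ = L * ℓ - (τ p - τ q) := by ring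
  have hinj : S.InjOn τ := fun p hp q hq hpq => by simpa [hpq] using hτ p hp q hq
  obtain ⟨m, c, hc, hmono⟩ := exists_isTour_strictMono hS hne hinj
  have hcS : ∀ i, c i ∈ S := fun i => hc.2.subset (Set.mem_range_self i)
  exact ⟨m, c, hc, tourLength_le_of_monotone hmono.monotone (fun i j => hτ _ (hcS i) _ (hcS j))
    (hwrap _ (hcS _) _ (hcS _))⟩

end Tour

/-! ### Cyclic schedules -/

section TourSchedule

variable {P : Type*} [MetricSpace P] {m : ℕ} (c : Fin (m + 1) → P)

/-- The distance travelled along the closed tour `c` after `n` steps. -/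
noncomputable def tourDist (n : ℕ) : ℝ :=
  ∑ j ∈ Finset.range n, dist (c (Fin.ofNat (m + 1) j)) (c (Fin.ofNat (m + 1) j + 1))

theorem tourDist_succ (n : ℕ) : tourDist c (n + 1) =
    tourDist c n + dist (c (Fin.ofNat (m + 1) n)) (c (Fin.ofNat (m + 1) n + 1)) :=
  Finset.sum_range_succ _ _

theorem monotone_tourDist : Monotone (tourDist c) :=
  monotone_nat_of_le_succ fun n => by
    rw [tourDist_succ]
    exact le_add_of_nonneg_right dist_nonneg

theorem tourDist_val (i : Fin (m + 1)) : tourDist c i = arcLength c i := by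
  rw [tourDist, arcLength, ← Nat.Iio_eq_range, ← Fin.map_valEmbedding_Iio, Finset.sum_map]
  simp

theorem tourDist_length : tourDist c (m + 1) = tourLength c := by
  rw [tourDist, tourLength, Finset.sum_range]
  simp

theorem tourDist_add_length (n : ℕ) : tourDist c (n + (m + 1)) = tourDist c n + tourLength c := by
  induction n with
  | zero => rw [Nat.zero_add, tourDist_length]; simp [tourDist]
  | succ n ih =>
    have hmod : Fin.ofNat (m + 1) (n + (m + 1)) = Fin.ofNat (m + 1) n := by
      ext; simp [Fin.ofNat]
    rw [Nat.add_right_comm, tourDist_succ, ih, tourDist_succ, hmod]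
    ring

theorem tourDist_add_mul (n q : ℕ) :
    tourDist c (n + q * (m + 1)) = tourDist c n + q * tourLength c := by
  induction q with
  | zero => simp
  | succ q ih =>
    rw [Nat.succ_mul, ← Nat.add_assoc, tourDist_add_length, ih]
    push_cast
    ring

theorem tourDist_eq_arcLength_add (n : ℕ) :
    tourDist c n = arcLength c (Fin.ofNat (m + 1) n) + (n / (m + 1) : ℕ) * tourLength c := by
  rw [← tourDist_val, ← tourDist_add_mul, Fin.val_ofNat, Nat.mod_add_div']

theorem arcLength_le (i : Fin (m + 1)) : arcLength c i ≤ tourLength c := by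
  rw [← tourDist_val, ← tourDist_length]
  exact monotone_tourDist c i.is_lt.le

theorem tourLength_nonneg : 0 ≤ tourLength c := Finset.sum_nonneg fun _ _ => dist_nonneg

variable {c}

theorem tendsto_tourDist (hc : 0 < tourLength c) :
    Filter.Tendsto (tourDist c) Filter.atTop Filter.atTop := by
  refine Filter.tendsto_atTop_atTop_of_monotone (monotone_tourDist c) fun b => ?_
  obtain ⟨q, hq⟩ := exists_nat_ge (b / tourLength c)
  refine ⟨0 + q * (m + 1), ?_⟩
  rw [tourDist_add_mul]
  simpa [tourDist] using (div_le_iff₀ hc).1 hq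

theorem eq_of_tourLength_eq_zero (h : tourLength c = 0) (i : Fin (m + 1)) : c i = c 0 := by
  have hstep : ∀ i, c (i + 1) = c i := fun i =>
    (dist_eq_zero.1 ((Finset.sum_eq_zero_iff_of_nonneg fun _ _ => dist_nonneg).1 h i
      (Finset.mem_univ i))).symm
  induction i using Fin.induction with
  | zero => rfl
  | succ i ih => rw [← Fin.coeSucc_eq_succ, hstep, ih]

theorem tourAt_iff_of_tourLength_eq_zero (h : tourLength c = 0) {x : ℝ} {p : P} :
    TourAt c x p ↔ c 0 = p := by
  constructor
  · rintro (⟨-, i, rfl⟩ | ⟨i, -, rfl, -⟩) <;> exact (eq_of_tourLength_eq_zero h i).symm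
  · rintro rfl
    exact .inl ⟨h, 0, rfl⟩

theorem tourAt_iff_exists_tourDist_eq (hc : 0 < tourLength c) {x : ℝ} {q : ℕ}
    (hx : tourLength c ≤ x + q * tourLength c) {p : P} :
    TourAt c x p ↔ ∃ n, c (Fin.ofNat (m + 1) n) = p ∧ tourDist c n = x + q * tourLength c := by
  constructor
  · rintro (⟨h, -⟩ | ⟨i, z, rfl, rfl⟩)
    · exact absurd h hc.ne'
    have hzq : (0 : ℝ) ≤ z + q := by
      refine nonneg_of_mul_nonneg_left ?_ hc
      linarith [arcLength_le c i]
    obtain ⟨r, hr⟩ := Int.eq_ofNat_of_zero_le (a := z + q) (by exact_mod_cast hzq)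
    have hr' : (z : ℝ) + q = r := by exact_mod_cast hr
    refine ⟨i + r * (m + 1), congrArg c (by ext; simp [Fin.ofNat, Nat.mod_eq_of_lt i.is_lt]), ?_⟩
    rw [tourDist_add_mul, tourDist_val, ← hr']
    ring
  · rintro ⟨n, rfl, hn⟩
    refine .inr ⟨_, (n / (m + 1) : ℕ) - q, rfl, ?_⟩
    rw [tourDist_eq_arcLength_add] at hn
    rw [Int.cast_sub, Int.cast_natCast, Int.cast_natCast]
    linarith

theorem exists_visitsAt_iff_eq (s : P) :
    ∃ f : RobotSchedule P, ∀ t, 0 ≤ t → ∀ p, f.VisitsAt p t ↔ s = p := by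
  refine ⟨{
    site := fun _ => s
    arrive := fun n => n
    depart := fun n => n + 1
    arrive_nonneg := Nat.cast_nonneg 0
    arrive_le_depart := fun n => le_add_of_nonneg_right zero_le_one
    speed_limit := fun n => by simp
    tendsto_arrive := tendsto_natCast_atTop_atTop }, fun t ht p => ⟨?_, fun h => ?_⟩⟩
  · rintro ⟨n, h, -, -⟩
    exact h
  · exact ⟨⌊t⌋₊, h, Nat.floor_le ht, (Nat.lt_floor_add_one t).le⟩

theorem exists_visitsAt_iff_tourDist_eq (hc : 0 < tourLength c) (y : ℝ) :
    ∃ f : RobotSchedule P, ∀ t, 0 ≤ t → ∀ p,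
      f.VisitsAt p t ↔ ∃ n, c (Fin.ofNat (m + 1) n) = p ∧ tourDist c n = t + y := by
  classical
  have hfirst := ((tendsto_tourDist hc).eventually_ge_atTop y).exists
  let n₀ := Nat.find hfirst
  refine ⟨{
    site := fun n => c (Fin.ofNat (m + 1) (n + n₀))
    arrive := fun n => tourDist c (n + n₀) - y
    depart := fun n => tourDist c (n + n₀) - y
    arrive_nonneg := by
      rw [Nat.zero_add, sub_nonneg]
      exact Nat.find_spec hfirst
    arrive_le_depart := fun n => le_rfl
    speed_limit := fun n => ?_
    tendsto_arrive := Filter.tendsto_atTop_add_const_right _ _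
      ((tendsto_tourDist hc).comp (Filter.tendsto_add_atTop_nat n₀)) }, fun t ht p => ⟨?_, ?_⟩⟩
  · have hnext : Fin.ofNat (m + 1) (n + 1 + n₀) = Fin.ofNat (m + 1) (n + n₀) + 1 := by
      ext
      simp [Fin.ofNat, Fin.val_add, Nat.add_right_comm]
    rw [hnext, Nat.add_right_comm n 1, tourDist_succ]
    linarith
  · rintro ⟨n, hp, harrive, hdepart⟩
    exact ⟨n + n₀, hp, by linarith [harrive, hdepart]⟩
  · rintro ⟨n, rfl, hn⟩
    obtain ⟨l, rfl⟩ := Nat.exists_eq_add_of_le' (Nat.find_min' hfirst (m := n) (by linarith))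
    exact ⟨l, rfl, (sub_eq_of_eq_add hn).le, (sub_eq_of_eq_add hn).ge⟩

theorem exists_visitsAt_iff_tourAt (c : Fin (m + 1) → P) (x : ℝ) :
    ∃ f : RobotSchedule P, ∀ t, 0 ≤ t → ∀ p, f.VisitsAt p t ↔ TourAt c (t + x) p := by
  obtain hzero | hpos := (tourLength_nonneg c).eq_or_lt'
  · simpa only [tourAt_iff_of_tourLength_eq_zero hzero] using exists_visitsAt_iff_eq (c 0)
  · obtain ⟨q, hq⟩ := exists_nat_ge ((tourLength c - x) / tourLength c)
    rw [div_le_iff₀ hpos] at hq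
    obtain ⟨f, hf⟩ := exists_visitsAt_iff_tourDist_eq hpos (x + q * tourLength c)
    refine ⟨f, fun t ht p => ?_⟩
    rw [tourAt_iff_exists_tourDist_eq (q := q) hpos (by linarith), add_assoc]
    exact hf t ht p

theorem exists_tourAt_add_mul_div (i : Fin (m + 1)) {n : ℕ} (hn : 0 < n) {a b : ℝ} (hab : a < b)
    (h : tourLength c / n < b - a) :
    ∃ j : Fin n, ∃ t ∈ Set.Ioo a b, TourAt c (t + j * (tourLength c / n)) (c i) := by
  obtain hzero | hpos := (tourLength_nonneg c).eq_or_lt'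
  · obtain ⟨t, ht⟩ := exists_between hab
    exact ⟨⟨0, hn⟩, t, ht, .inl ⟨hzero, i, rfl⟩⟩
  have hn' : (0 : ℝ) < n := Nat.cast_pos.2 hn
  set δ := tourLength c / n with hδ
  have hlen : tourLength c = n * δ := by rw [hδ, mul_div_cancel₀ _ hn'.ne']
  obtain ⟨u, hu, -⟩ := existsUnique_add_zsmul_mem_Ioc (div_pos hpos hn') (arcLength c i) a
  rw [zsmul_eq_mul] at hu
  have hnz : (0 : ℤ) < n := Nat.cast_pos.2 hn
  obtain ⟨j, hj⟩ := Int.eq_ofNat_of_zero_le (Int.emod_nonneg (-u) hnz.ne')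
  have hjn : j < n := by exact_mod_cast hj ▸ Int.emod_lt_of_pos (-u) hnz
  have hdiv : (j : ℝ) + n * ((-u / n : ℤ) : ℝ) = -u := by
    exact_mod_cast hj ▸ Int.emod_add_mul_ediv (-u) n
  refine ⟨⟨j, hjn⟩, arcLength c i + u * δ, ⟨hu.1, hu.2.trans_lt (by linarith)⟩,
    .inr ⟨i, -(-u / n), rfl, ?_⟩⟩
  rw [hlen, Int.cast_neg]
  linear_combination δ * hdiv

end TourSchedule

section Cyclic

variable {P : Type*} [MetricSpace P] {k : ℕ}

theorem CyclicPlan.exists_isCyclic_latency_le (C : CyclicPlan P k) {M : ℝ}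
    (hM : ∀ i, tourLength (C.tour i) ≤ M * C.numRobots i) :
    ∃ σ : Schedule P k, σ.IsCyclic ∧ σ.latency ≤ ENNReal.ofReal M := by
  choose F hF using fun x : Σ i, Fin (C.numRobots i) => exists_visitsAt_iff_tourAt (C.tour x.1)
    (x.2 * (tourLength (C.tour x.1) / C.numRobots x.1))
  have hσ : ∀ x t, 0 ≤ t → ∀ p, (F (C.robot.symm (C.robot x))).VisitsAt p t ↔
      TourAt (C.tour x.1) (t + x.2 * (tourLength (C.tour x.1) / C.numRobots x.1)) p := fun x => by
    rw [Equiv.symm_apply_apply]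
    exact hF x
  refine ⟨fun z => F (C.robot.symm z), ⟨C, 0, fun i j t ht p => ?_⟩, ?_⟩
  · rw [hσ ⟨i, j⟩ t ht p, Pi.zero_apply, zero_add]
  · refine iSup_le fun p => iSup_le fun a => iSup_le fun b => iSup_le fun ha => iSup_le fun hab =>
      iSup_le fun hno => ENNReal.ofReal_le_ofReal ?_
    obtain ⟨i, hi⟩ := C.group_cover p
    rw [← (C.isTSPTour i).1.2] at hi
    obtain ⟨l, rfl⟩ := hi
    by_contra! hlt
    have hspacing : tourLength (C.tour i) / C.numRobots i < b - a :=
      ((div_le_iff₀ (Nat.cast_pos.2 (C.numRobots_pos i))).2 (hM i)).trans_lt hlt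
    obtain ⟨j, t, ht, hvisit⟩ := exists_tourAt_add_mul_div l (C.numRobots_pos i) hab hspacing
    exact hno t ht.1 ht.2 _ ((hσ ⟨i, j⟩ t (ha.trans ht.1.le) _).2 hvisit)

theorem exists_cyclicPlan [Finite P] {ι : Type*} [Finite ι] {κ : P → ι} {ρ : Fin k → ι}
    (hκ : κ.Surjective) (hρ : ρ.Surjective) :
    ∃ C : CyclicPlan P k, ∀ i, ∃ x, C.group i = κ ⁻¹' {x} ∧ C.numRobots i = (ρ ⁻¹' {x}).ncard := by
  let e := (Finite.equivFin ι).symm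
  choose m c hc using fun i => exists_isTSPTour (Set.toFinite (κ ⁻¹' {e i}))
    ((Set.singleton_nonempty (e i)).preimage hκ)
  exact ⟨{
    numGroups := Nat.card ι
    group := fun i => κ ⁻¹' {e i}
    group_nonempty := fun i => (hc i).1.nonempty
    group_disjoint := fun i j hij =>
      (Set.disjoint_singleton.2 (e.injective.ne hij)).preimage κ
    group_cover := fun p => ⟨e.symm (κ p), (e.apply_symm_apply (κ p)).symm⟩
    lastIndex := m
    tour := c
    isTSPTour := hc
    numRobots := fun i => (ρ ⁻¹' {e i}).ncard
    numRobots_pos := fun i => (Set.ncard_pos (Set.toFinite _)).2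
      ((Set.singleton_nonempty (e i)).preimage hρ)
    robot := ((Equiv.sigmaCongrRight fun i => (Finite.equivFin (ρ ⁻¹' {e i})).symm).trans
      (Equiv.sigmaCongrLeft (β := fun x => {z // ρ z = x}) e)).trans (Equiv.sigmaFiberEquiv ρ) },
    fun i => ⟨e i, rfl, rfl⟩⟩

namespace Grouping

/-- The robots of the groups without sites join another group. -/
theorem exists_cyclicPlan [Finite P] [Nonempty P] (g : Grouping (Fin k) P) :
    ∃ C : CyclicPlan P k, ∀ i, ∃ z, C.group i = g.sites z ∧ #(g.robots z) ≤ C.numRobots i := by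
  let κ := Set.rangeFactorization fun p => Quotient.mk g.setoid (g.robotOf p)
  let ρ : Fin k → Set.range fun p => Quotient.mk g.setoid (g.robotOf p) := fun z =>
    Function.invFun Subtype.val (Quotient.mk g.setoid z)
  have hρ : ∀ {z p}, g.setoid z (g.robotOf p) → ρ z = κ p := fun {z p} h => by
    rw [← Function.leftInverse_invFun Subtype.val_injective (κ p)]
    exact congrArg (Function.invFun Subtype.val) (Quotient.sound h)
  have hκsurj : κ.Surjective := Set.rangeFactorization_surjective
  have hρsurj : ρ.Surjective := hκsurj.forall.2 fun p => ⟨_, hρ (g.setoid.refl _)⟩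
  obtain ⟨C, hC⟩ := Patrol.exists_cyclicPlan hκsurj hρsurj
  refine ⟨C, fun i => ?_⟩
  obtain ⟨x, hgroup, hrobots⟩ := hC i
  obtain ⟨p, rfl⟩ := hκsurj x
  refine ⟨g.robotOf p, hgroup.trans ?_, ?_⟩
  · ext q
    exact Subtype.ext_iff.trans Quotient.eq
  · rw [hrobots, ← Set.ncard_coe_finset]
    exact Set.ncard_le_ncard fun z hz => hρ (by simpa [robots] using hz)

/-- The robots of each group, evenly spaced on a travelling salesman tour of its sites, visit each
of these sites every `M` units of time. -/
def HasLatency (g : Grouping (Fin k) P) (M : ℝ) : Prop :=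
  ∀ (z : Fin k) (m : ℕ) (c : Fin (m + 1) → P), IsTSPTour (g.sites z) c →
    tourLength c ≤ M * #(g.robots z)

theorem HasLatency.exists_isCyclic_latency_le [Finite P] [Nonempty P] {g : Grouping (Fin k) P}
    {M : ℝ} (hM : 0 ≤ M) (h : g.HasLatency M) :
    ∃ σ : Schedule P k, σ.IsCyclic ∧ σ.latency ≤ ENNReal.ofReal M := by
  obtain ⟨C, hC⟩ := g.exists_cyclicPlan
  refine C.exists_isCyclic_latency_le fun i => ?_
  obtain ⟨z, hgroup, hrobots⟩ := hC i
  calc tourLength (C.tour i) ≤ M * #(g.robots z) := h z _ _ (hgroup ▸ C.isTSPTour i)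
    _ ≤ M * C.numRobots i := by gcongr

theorem isClosed_setOf_hasLatency (g : Grouping (Fin k) P) : IsClosed {M | g.HasLatency M} := by
  simp only [HasLatency, Set.ofPred_forall]
  exact isClosed_iInter fun z => isClosed_iInter fun m => isClosed_iInter fun c =>
    isClosed_iInter fun _ => isClosed_le continuous_const (continuous_mul_const _)

instance [Finite P] : Finite (Grouping (Fin k) P) :=
  .of_injective (fun g => (g.setoid.r, g.robotOf)) fun g g' h => by
    obtain ⟨hr, hrobotOf⟩ := Prod.mk.inj h
    exact Grouping.ext (Setoid.ext fun a b => iff_of_eq (congrFun₂ hr a b)) hrobotOf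

end Grouping

theorem optimalLatency_ne_top [Finite P] [Nonempty P] [Nonempty (Fin k)] :
    optimalLatency P k ≠ ⊤ := by
  obtain ⟨m, c, hc⟩ := exists_isTSPTour (Set.toFinite (Set.univ : Set P)) Set.univ_nonempty
  let g : Grouping (Fin k) P := ⟨⊤, fun _ => Classical.arbitrary _⟩
  have hg : g.HasLatency (tourLength c) := fun z m' c' hc' => by
    have hsites : g.sites z = Set.univ := Set.eq_univ_of_forall fun _ => trivial
    have hrobots : 0 < #(g.robots z) := Finset.card_pos.2 ⟨z, by simp [Grouping.robots, g]⟩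
    calc tourLength c' ≤ tourLength c := hc'.tourLength_le (hsites ▸ hc.1)
      _ ≤ tourLength c * #(g.robots z) :=
        le_mul_of_one_le_right (tourLength_nonneg c) (Nat.one_le_cast.2 hrobots)
  obtain ⟨σ, -, hσ⟩ := hg.exists_isCyclic_latency_le (tourLength_nonneg c)
  exact ((iInf_le _ σ).trans hσ).trans_lt ENNReal.ofReal_lt_top |>.ne

variable [Finite P]

theorem Schedule.exists_hasLatency [Nontrivial (Fin k)] (σ : Schedule P k) {L : ℝ} (hL : 0 < L)
    (h : σ.latency < ENNReal.ofReal L) :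
    ∃ g : Grouping (Fin k) P, g.HasLatency ((2 - 2 / k) * L) := by
  obtain ⟨D, hD⟩ := σ.exists_patrolRecord hL h
  obtain ⟨g, hg⟩ := D.hasGrouping
  refine ⟨g, fun z m c hc => ?_⟩
  obtain ⟨y, hw⟩ := hg z
  obtain ⟨m', c', hc', hlen⟩ := hw.exists_isTour (Set.toFinite _) hc.1.nonempty hL.le fun p q => by
    rw [hD, mul_inv_cancel_left₀ hL.ne']
  calc tourLength c ≤ tourLength c' := hc.tourLength_le hc'
    _ ≤ L * ((2 - 2 / Fintype.card (Fin k)) * #(g.robots z)) := hlen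
    _ = (2 - 2 / k) * L * #(g.robots z) := by rw [Fintype.card_fin]; ring

theorem exists_hasLatency_optimalLatency [Nonempty P] [Nontrivial (Fin k)] :
    ∃ g : Grouping (Fin k) P, g.HasLatency ((2 - 2 / k) * (optimalLatency P k).toReal) := by
  have hclosed : IsClosed {L : ℝ | ∃ g : Grouping (Fin k) P, g.HasLatency ((2 - 2 / k) * L)} := by
    rw [Set.ofPred_exists]
    exact isClosed_iUnion_of_finite fun g =>
      g.isClosed_setOf_hasLatency.preimage (continuous_const_mul _)
  have hsub : Set.Ioi (optimalLatency P k).toReal ⊆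
      {L : ℝ | ∃ g : Grouping (Fin k) P, g.HasLatency ((2 - 2 / k) * L)} := fun L hL => by
    obtain ⟨σ, hσ⟩ := iInf_lt_iff.1 ((ENNReal.lt_ofReal_iff_toReal_lt optimalLatency_ne_top).2 hL)
    exact σ.exists_hasLatency (ENNReal.toReal_nonneg.trans_lt hL) hσ
  refine hclosed.closure_subset_iff.2 hsub ?_
  rw [closure_Ioi]
  exact Set.self_mem_Ici

end Cyclic

end Patrol

theorem mainTheorem1 {P : Type*} [MetricSpace P] [Finite P] [Nonempty P] (k : ℕ) (hk : 2 ≤ k) :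
    ∃ σ : Patrol.Schedule P k, σ.IsCyclic ∧
      σ.latency ≤ ENNReal.ofReal (2 * (1 - 1 / (k : ℝ))) * Patrol.optimalLatency P k := by
  have : Nontrivial (Fin k) := Fin.nontrivial_iff_two_le.2 hk
  have hfactor : 2 * (1 - 1 / (k : ℝ)) = 2 - 2 / k := by ring
  have hfactor_nonneg : 0 ≤ 2 - 2 / (k : ℝ) := by
    rw [sub_nonneg]
    exact div_le_self zero_le_two (Nat.one_le_cast.2 (one_le_two.trans hk))
  obtain ⟨g, hg⟩ := Patrol.exists_hasLatency_optimalLatency (P := P) (k := k)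
  obtain ⟨σ, hσ, hlat⟩ :=
    hg.exists_isCyclic_latency_le (mul_nonneg hfactor_nonneg ENNReal.toReal_nonneg)
  refine ⟨σ, hσ, hlat.trans_eq ?_⟩
  rw [hfactor, ENNReal.ofReal_mul hfactor_nonneg,
    ENNReal.ofReal_toReal Patrol.optimalLatency_ne_top]
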